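/- **Setting.** Let $T>0$ and $n,m\ge 0$ be integers. Let $A:[0,T]\times\mathbb{R}^n\to\mathbb{R}^n$, $B:[0,T]\times\mathbb{R}^n\to\mathbb{R}^{n\times m}$, $Q:[0,T]\times\mathbb{R}^n\to\mathbb{R}$, $S:[0,T]\times\mathbb{R}^n\to\mathbb{R}^m$, $R:[0,T]\times\mathbb{R}^n\to\mathbb{S}^m$ (the symmetric $m\times m$ matrices) and $G:\mathbb{R}^n\to\mathbb{R}$. For $t\in[0,T]$ the admissible controls on $[t,T]$ are the $u\in L^2(t,T;\mathbb{R}^m)$. For $x\in\mathbb{R}^n$ and an admissible $u$ let $X(\cdot)=X(\cdot\,;t,x,u)$ be the (Carathéodory) solution of $$\dot X(s)=A(s,X(s))+B(s,X(s))u(s),\quad s\in[t,T],\qquad X(t)=x,$$ and put $$J(t,x;u)=\int_t^T\Big[Q(s,X(s))+\langle S(s,X(s)),u(s)\rangle+\tfrac12\langle R(s,X(s))u(s),u(s)\rangle\Big]ds+G(X(T)),\qquad V(t,x)=\inf_{u}J(t,x;u).$$ A pair $(X^*,u^*)$ is an optimal pair for $(t,x)$ if $u^*$ is admissible on $[t,T]$,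 $X^*=X(\cdot\,;t,x,u^*)$ and $J(t,x;u^*)=V(t,x)$. **Hypotheses.** (H1) $A$ and $B$ are continuous, and there are constants $L_A,L_B,\tilde L_B>0$ such that for all $t\in[0,T]$, $x,\bar x\in\mathbb{R}^n$, $u\in\mathbb{R}^m$: $|A(t,x)-A(t,\bar x)|\le L_A|x-\bar x|$, $|B(t,x)-B(t,\bar x)|\le\tilde L_B|x-\bar x|$ and $\langle[B(t,x)-B(t,\bar x)]^T(x-\bar x),u\rangle\le L_B|x-\bar x|^2$. (H2) $Q,S,R,G$ are continuous, and there are constants $L,Q_0,G_0,S_0>0$, $\varepsilon_0\in(0,1)$, $\rho_0>0$ and a continuous function $\rho:\mathbb{R}^n\to[\rho_0,\infty)$ such that for all $(t,x)\in[0,T]\times\mathbb{R}^n$: $R(t,x)\ge\rho(x)I$; $(1-\varepsilon_0)Q(t,x)-\frac12S(t,x)^TR(t,x)^{-1}S(t,x)\ge-L$ and $G(x)\ge-L$; $Q(t,x)\le Q_0(1+|x|^2)$, $G(x)\le G_0(1+|x|^2)$, $|S(t,x)|\le S_0(1+|x|)$; $|A(t,x)+B(t,x)R(t,x)^{-1}S(t,x)|\le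 L(1+|x|)$ and $|B(t,x)R(t,x)^{-1}B(t,x)^T|\le L$. (H3) $A,B,Q,S,R$ are twice continuously differentiable on $[0,T]\times\mathbb{R}^n$ (one-sided in time at $0$ and $T$), and $G$ is twice continuously differentiable on $\mathbb{R}^n$. **Proposition 6.1.** Assume (H1)–(H3), and that $B(t,x)=B(t)$ and $R(t,x)=R(t)$ do not depend on $x$. Suppose that the value function $V$ is twice (Fréchet) differentiable on $[0,T]\times\mathbb{R}^n$ (one-sided in time at $0$ and $T$). Then $P:=V_x^T$ is a solution of the quasi-Riccati equation: $P$ is differentiable on $[0,T]\times\mathbb{R}^n$ (one-sided in time at $0$ and $T$), and $$\begin{cases}P_t(t,x)+P_x(t,x)A(t,x)+A_x(t,x)^TP(t,x)+Q_x(t,x)^T\\ \quad-\,[P_x(t,x)B(t)+S_x(t,x)^T]R(t)^{-1}[B(t)^TP(t,x)+S(t,x)]=0,&(t,x)\in[0,T]\times\mathbb{R}^n,\\ P(T,x)=G_x(x)^T,&x\in\mathbb{R}^n.\end{cases}$$ Moreover, for every $(t,x)\in[0,T]\times\mathbb{R}^n$ and every optimal pair $(X^*,u^*)$ for $(t,x)$,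 the optimal control has the state feedback representation $$u^*(s)=-R(s)^{-1}\big[B(s)^TP(s,X^*(s))+S(s,X^*(s))\big]\qquad\text{for a.e. } s\in[t,T].$$ -/

import Mathlib

open MeasureTheory Set

noncomputable section

/-- The Euclidean space `ℝᵏ`. -/
abbrev Euc (k : ℕ) := EuclideanSpace ℝ (Fin k)

/-- The data of a deterministic affine quadratic optimal control problem on `[0, T]` with state
space `ℝⁿ` and control set `ℝᵐ`. Matrices are represented by the linear maps between Euclidean
spaces that they define (so that the transpose is the adjoint and `|·|` is the operator norm).
Only the values for times in `[0, T]` matter. -/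
structure AQProblem (n m : ℕ) where
  /-- the time horizon -/
  T : ℝ
  T_pos : 0 < T
  /-- the drift -/
  A : ℝ → Euc n → Euc n
  /-- the control coefficient, an `n × m` matrix -/
  B : ℝ → Euc n → (Euc m →L[ℝ] Euc n)
  /-- the running cost that does not involve the control -/
  Q : ℝ → Euc n → ℝ
  /-- the coefficient of the part of the running cost that is linear in the control -/
  S : ℝ → Euc n → Euc m
  /-- the weight of the quadratic part of the running cost, an `m × m` matrix -/
  R : ℝ → Euc n → (Euc m →L[ℝ] Euc m)
  /-- the terminal cost -/
  G : Euc n → ℝ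

namespace AQProblem

variable {n m : ℕ} (D : AQProblem n m)

/-- The domain `[0, T] × ℝⁿ`. -/
def dom : Set (ℝ × Euc n) := Icc 0 D.T ×ˢ univ

/-- Hypothesis (H1), for the control set `U = ℝᵐ`. -/
def H1 : Prop :=
  ContinuousOn (fun p : ℝ × Euc n => D.A p.1 p.2) D.dom ∧
  ContinuousOn (fun p : ℝ × Euc n => D.B p.1 p.2) D.dom ∧
  ∃ LA LB LB' : ℝ, 0 < LA ∧ 0 < LB ∧ 0 < LB' ∧
    (∀ t ∈ Icc 0 D.T, ∀ x y : Euc n, ‖D.A t x - D.A t y‖ ≤ LA * ‖x - y‖) ∧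
    (∀ t ∈ Icc 0 D.T, ∀ x y : Euc n, ‖D.B t x - D.B t y‖ ≤ LB' * ‖x - y‖) ∧
    (∀ t ∈ Icc 0 D.T, ∀ (u : Euc m) (x y : Euc n),
      inner ℝ (ContinuousLinearMap.adjoint (D.B t x - D.B t y) (x - y)) u ≤ LB * ‖x - y‖ ^ 2)

/-- Hypothesis (H2). The condition `R(t, x) ≥ ρ(x) I` is the inequality of quadratic forms. -/
def H2 : Prop :=
  ContinuousOn (fun p : ℝ × Euc n => D.Q p.1 p.2) D.dom ∧
  ContinuousOn (fun p : ℝ × Euc n => D.S p.1 p.2) D.dom ∧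
  ContinuousOn (fun p : ℝ × Euc n => D.R p.1 p.2) D.dom ∧
  Continuous D.G ∧
  (∀ t ∈ Icc 0 D.T, ∀ x : Euc n, IsSelfAdjoint (D.R t x)) ∧
  ∃ (L Q₀ G₀ S₀ ε₀ ρ₀ : ℝ) (ρ : Euc n → ℝ),
    0 < L ∧ 0 < Q₀ ∧ 0 < G₀ ∧ 0 < S₀ ∧ 0 < ε₀ ∧ ε₀ < 1 ∧ 0 < ρ₀ ∧
    Continuous ρ ∧ (∀ x, ρ₀ ≤ ρ x) ∧
    (∀ x, -L ≤ D.G x) ∧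
    (∀ x, D.G x ≤ G₀ * (1 + ‖x‖ ^ 2)) ∧
    ∀ t ∈ Icc 0 D.T, ∀ x : Euc n,
      (∀ u : Euc m, ρ x * ‖u‖ ^ 2 ≤ inner ℝ (D.R t x u) u) ∧
      -L ≤ (1 - ε₀) * D.Q t x - 1 / 2 * inner ℝ (D.S t x) ((D.R t x).inverse (D.S t x)) ∧
      D.Q t x ≤ Q₀ * (1 + ‖x‖ ^ 2) ∧
      ‖D.S t x‖ ≤ S₀ * (1 + ‖x‖) ∧
      ‖D.A t x + D.B t x ((D.R t x).inverse (D.S t x))‖ ≤ L * (1 + ‖x‖) ∧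
      ‖D.B t x ∘L (D.R t x).inverse ∘L ContinuousLinearMap.adjoint (D.B t x)‖ ≤ L

/-- Hypothesis (H3): the coefficients are twice continuously differentiable
(up to the boundary times `0` and `T`). -/
def H3 : Prop :=
  ContDiffOn ℝ 2 (fun p : ℝ × Euc n => D.A p.1 p.2) D.dom ∧
  ContDiffOn ℝ 2 (fun p : ℝ × Euc n => D.B p.1 p.2) D.dom ∧
  ContDiffOn ℝ 2 (fun p : ℝ × Euc n => D.Q p.1 p.2) D.dom ∧
  ContDiffOn ℝ 2 (fun p : ℝ × Euc n => D.S p.1 p.2) D.dom ∧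
  ContDiffOn ℝ 2 (fun p : ℝ × Euc n => D.R p.1 p.2) D.dom ∧
  ContDiff ℝ 2 D.G

/-- Admissible controls on `[t, T]`: square integrable functions with values in `ℝᵐ`. -/
def IsAdmissible (t : ℝ) (u : ℝ → Euc m) : Prop :=
  MemLp u 2 (volume.restrict (Icc t D.T))

/-- `X` solves `Ẋ(s) = A(s, X(s)) + B(s, X(s)) u(s)` on `[t, T]`, `X(t) = x`, in the sense of
Carathéodory, i.e. the integrated equation holds. -/
def IsTrajectory (t : ℝ) (x : Euc n) (u : ℝ → Euc m) (X : ℝ → Euc n) : Prop :=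
  ContinuousOn X (Icc t D.T) ∧
  IntegrableOn (fun r => D.A r (X r) + D.B r (X r) (u r)) (Icc t D.T) ∧
  ∀ s ∈ Icc t D.T, X s = x + ∫ r in t..s, (D.A r (X r) + D.B r (X r) (u r))

/-- `u` is an admissible control on `[t, T]` and `X` is the trajectory that starts from `(t, x)`
under `u`. -/
def IsAdmissiblePair (t : ℝ) (x : Euc n) (X : ℝ → Euc n) (u : ℝ → Euc m) : Prop :=
  D.IsAdmissible t u ∧ D.IsTrajectory t x u X

/-- The cost `J(t, x; u)` of the control `u` with trajectory `X` on `[t, T]`. -/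
def cost (t : ℝ) (X : ℝ → Euc n) (u : ℝ → Euc m) : ℝ :=
  (∫ s in t..D.T, (D.Q s (X s) + inner ℝ (D.S s (X s)) (u s)
      + 1 / 2 * inner ℝ (D.R s (X s) (u s)) (u s)))
    + D.G (X D.T)

/-- The value function `V(t, x)`: the infimum of the cost over all admissible controls on
`[t, T]` (each with its trajectory from `(t, x)`). -/
def value (t : ℝ) (x : Euc n) : ℝ :=
  sInf {c : ℝ | ∃ (X : ℝ → Euc n) (u : ℝ → Euc m), D.IsAdmissiblePair t x X u ∧ c = D.cost t X u}

/-- `(X, u)` is an optimal pair for the initial pair `(t, x)`. -/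
def IsOptimalPair (t : ℝ) (x : Euc n) (X : ℝ → Euc n) (u : ℝ → Euc m) : Prop :=
  D.IsAdmissiblePair t x X u ∧ D.cost t X u = D.value t x

/-- A real function of time and state is twice (Fréchet) differentiable on `[0, T] × ℝⁿ`
(one-sided in time at the times `0` and `T`). -/
def TwiceDifferentiable (W : ℝ → Euc n → ℝ) : Prop :=
  DifferentiableOn ℝ (fun p : ℝ × Euc n => W p.1 p.2) D.dom ∧
  DifferentiableOn ℝ (fderivWithin ℝ (fun p : ℝ × Euc n => W p.1 p.2) D.dom) D.dom

/-- The (classical) solutions `P : [0, T] × ℝⁿ → ℝⁿ` of the quasi-Riccati equation of the problem,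
when the control coefficient `B₀` and the weight `R₀` depend on time only:
`P_t + P_x A + A_xᵀ P + Q_xᵀ - (P_x B₀ + S_xᵀ) R₀⁻¹ (B₀ᵀ P + S) = 0` on `[0, T] × ℝⁿ` and
`P(T, ·) = G_xᵀ`. The time derivative is one-sided at the times `0` and `T`. -/
def SolvesQuasiRiccati (B₀ : ℝ → (Euc m →L[ℝ] Euc n)) (R₀ : ℝ → (Euc m →L[ℝ] Euc m))
    (P : ℝ → Euc n → Euc n) : Prop :=
  DifferentiableOn ℝ (fun p : ℝ × Euc n => P p.1 p.2) D.dom ∧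
  (∀ t ∈ Icc 0 D.T, ∀ x : Euc n,
    derivWithin (fun s => P s x) (Icc 0 D.T) t
      + fderiv ℝ (P t) x (D.A t x)
      + ContinuousLinearMap.adjoint (fderiv ℝ (D.A t) x) (P t x)
      + gradient (D.Q t) x
      - (fderiv ℝ (P t) x ∘L B₀ t + ContinuousLinearMap.adjoint (fderiv ℝ (D.S t) x))
          ((R₀ t).inverse (ContinuousLinearMap.adjoint (B₀ t) (P t x) + D.S t x)) = 0) ∧
  ∀ x : Euc n, P D.T x = gradient D.G x

end AQProblem

end

/-! The quasi-Riccati equation is the space gradient of the Hamilton–Jacobi–Bellman (HJB) equation.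
Along any trajectory, the integral of the Hamiltonian (rate of change of `V` plus running cost) is
the cost minus the value (`cost_sub_value`). Completing the square in the control (`hamiltonian_eq`)
splits the Hamiltonian into its minimum and a nonnegative term vanishing only at the feedback
control.

The minimum is zero (`minHamiltonian_eq_zero`). It is nonnegative by dynamic programming with
constant controls. If it were positive at some point, near-optimal controls, whose energy is bounded
by coercivity (`H2.exists_cost_lower_bound`), would keep the state near that point for a uniform
time (`exists_forall_norm_sub_le`) and pay an excess cost bounded below.

For an optimal pair the integral of the Hamiltonian vanishes, hence so does the squared term almost
everywhere, which gives the feedback formula. Differentiating the HJB equation in `x` and using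
symmetry of the second derivative of `V` gives the quasi-Riccati equation (`quasiRiccati`). -/

noncomputable section

/-! ### Chain rule along absolutely continuous curves -/

/-- A function whose oscillation is dominated by that of an absolutely continuous function is
absolutely continuous. -/
theorem AbsolutelyContinuousOnInterval.of_dist_le {X Y : Type*} [PseudoMetricSpace X]
    [PseudoMetricSpace Y] {f : ℝ → X} {g : ℝ → Y} {a b : ℝ}
    (hf : AbsolutelyContinuousOnInterval f a b)
    (hgf : ∀ r ∈ uIcc a b, ∀ s ∈ uIcc a b, dist (g r) (g s) ≤ dist (f r) (f s)) :
    AbsolutelyContinuousOnInterval g a b := by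
  rw [absolutelyContinuousOnInterval_iff] at hf ⊢
  intro ε hε
  obtain ⟨δ, hδ, h⟩ := hf ε hε
  refine ⟨δ, hδ, fun E hE hlt => lt_of_le_of_lt (Finset.sum_le_sum fun i hi => ?_) (h E hE hlt)⟩
  exact hgf _ (hE.1 i hi).1 _ (hE.1 i hi).2

section ChainRule

variable {E : Type*} [NormedAddCommGroup E] [NormedSpace ℝ E] [CompleteSpace E]

theorem hasDerivAt_of_eq_add_integral {X f : ℝ → E} {a b : ℝ} {x : E} (hab : a ≤ b)
    (hf : IntervalIntegrable f volume a b) (hX : ∀ s ∈ Icc a b, X s = x + ∫ r in a..s, f r) :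
    ∀ᵐ s, s ∈ Ioo a b → HasDerivAt X (f s) s := by
  filter_upwards [hf.ae_hasDerivAt_integral] with s hs hsab
  have h := hs (by rw [uIcc_of_le hab]; exact Ioo_subset_Icc_self hsab) a left_mem_uIcc
  refine (h.const_add x).congr_of_eventuallyEq ?_
  filter_upwards [isOpen_Ioo.mem_nhds hsab] with r hr using hX r (Ioo_subset_Icc_self hr)

omit [CompleteSpace E] in
theorem sub_eq_integral {X f : ℝ → E} {a b : ℝ} {x : E} (hab : a ≤ b)
    (hf : IntervalIntegrable f volume a b) (hX : ∀ s ∈ Icc a b, X s = x + ∫ r in a..s, f r)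
    {r s : ℝ} (hr : r ∈ Icc a b) (hs : s ∈ Icc a b) :
    X s - X r = ∫ z in r..s, f z := by
  have hi : ∀ c ∈ Icc a b, IntervalIntegrable f volume a c := fun c hc =>
    hf.mono_set (by rw [uIcc_of_le hab, uIcc_of_le hc.1]; exact Icc_subset_Icc_right hc.2)
  rw [hX s hs, hX r hr, add_sub_add_left_eq_sub,
    intervalIntegral.integral_interval_sub_left (hi s hs) (hi r hr)]

/-- The fundamental theorem of calculus for a `C¹` function along an absolutely continuous curve. -/
theorem integral_fderiv_along_curve [ProperSpace E] {X f : ℝ → E} {a b : ℝ} {x : E} (hab : a ≤ b)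
    (hf : IntervalIntegrable f volume a b) (hXc : ContinuousOn X (Icc a b))
    (hX : ∀ s ∈ Icc a b, X s = x + ∫ r in a..s, f r)
    {W : ℝ × E → ℝ} {W' : ℝ × E → (ℝ × E →L[ℝ] ℝ)}
    (hW : ∀ p ∈ Icc a b ×ˢ (univ : Set E), HasFDerivWithinAt W (W' p) (Icc a b ×ˢ univ) p)
    (hW' : ContinuousOn W' (Icc a b ×ˢ univ)) :
    ∫ s in a..b, W' (s, X s) (1, f s) = W (b, X b) - W (a, X a) := by
  obtain ⟨ρ, hρ⟩ := isCompact_Icc.exists_bound_of_continuousOn hXc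
  -- The curve stays in this compact convex set, where `W'` is bounded, so `W` is Lipschitz there by
  -- the mean value inequality.
  set K : Set (ℝ × E) := Icc a b ×ˢ Metric.closedBall 0 ρ with hK
  have hKsub : K ⊆ Icc a b ×ˢ univ := prod_mono_right (subset_univ _)
  have hKc : IsCompact K := isCompact_Icc.prod (isCompact_closedBall _ _)
  obtain ⟨M, hM⟩ := hKc.exists_bound_of_continuousOn (hW'.mono hKsub)
  have hlip : LipschitzOnWith (Real.toNNReal M) W K := by
    refine Convex.lipschitzOnWith_of_nnnorm_hasFDerivWithin_le (f' := W')
      (fun p hp => (hW p (hKsub hp)).mono hKsub) (fun p hp => ?_)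
      ((convex_Icc a b).prod (convex_closedBall _ _))
    rw [← NNReal.coe_le_coe]
    exact (hM p hp).trans (Real.le_coe_toNNReal M)
  have hmem : ∀ s ∈ Icc a b, (s, X s) ∈ K := fun s hs =>
    ⟨hs, mem_closedBall_zero_iff.2 (hρ s hs)⟩
  -- The increments of `φ` dominate those of `W` along the curve: the sup distance between two
  -- points of the curve is at most the elapsed time plus the integral of `‖f‖`.
  set φ : ℝ → ℝ := fun s => (Real.toNNReal M : ℝ) * (s + ∫ r in a..s, ‖f r‖) with hφ
  have hfn : IntervalIntegrable (fun r => ‖f r‖) volume a b := hf.norm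
  have hφac : AbsolutelyContinuousOnInterval φ a b := by
    refine AbsolutelyContinuousOnInterval.const_mul _ ?_
    refine AbsolutelyContinuousOnInterval.add (f := fun s => s) ?_
      (hfn.absolutelyContinuousOnInterval_intervalIntegral left_mem_uIcc)
    exact (LipschitzWith.id.lipschitzOnWith).absolutelyContinuousOnInterval
  have key : ∀ r ∈ Icc a b, ∀ s ∈ Icc a b, r ≤ s →
      dist (W (r, X r)) (W (s, X s)) ≤ dist (φ r) (φ s) := by
    intro r hr s hs hrs
    have hi : ∀ c ∈ Icc a b, IntervalIntegrable (fun r => ‖f r‖) volume a c := fun c hc =>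
      hfn.mono_set (by rw [uIcc_of_le hab, uIcc_of_le hc.1]; exact Icc_subset_Icc_right hc.2)
    have h1 : φ s - φ r = (Real.toNNReal M : ℝ) * ((s - r) + ∫ z in r..s, ‖f z‖) := by
      rw [hφ, ← intervalIntegral.integral_interval_sub_left (hi s hs) (hi r hr)]
      ring
    have h2 : ‖X s - X r‖ ≤ ∫ z in r..s, ‖f z‖ := by
      rw [sub_eq_integral hab hf hX hr hs]
      exact intervalIntegral.norm_integral_le_integral_norm hrs
    refine (hlip.dist_le_mul _ (hmem r hr) _ (hmem s hs)).trans ?_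
    rw [dist_comm (φ r), Real.dist_eq, h1]
    refine le_trans ?_ (le_abs_self _)
    gcongr
    rw [Prod.dist_eq]
    refine max_le ?_ ?_
    · rw [Real.dist_eq, abs_sub_comm, abs_of_nonneg (sub_nonneg.2 hrs)]
      linarith [(norm_nonneg _).trans h2]
    · rw [dist_comm, dist_eq_norm]
      linarith
  have hac : AbsolutelyContinuousOnInterval (fun s => W (s, X s)) a b := by
    refine hφac.of_dist_le fun r hr s hs => ?_
    rw [uIcc_of_le hab] at hr hs
    rcases le_total r s with h | h
    · exact key r hr s hs h
    · rw [dist_comm, dist_comm (φ r)]; exact key s hs r hr h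
  rw [← hac.integral_deriv_eq_sub]
  refine intervalIntegral.integral_congr_ae ?_
  have hne : ∀ᵐ s : ℝ, s ≠ b := by simp [ae_iff, measure_singleton]
  filter_upwards [hasDerivAt_of_eq_add_integral hab hf hX, hne] with s hs hsb hsab
  rw [uIoc_of_le hab] at hsab
  have hsI : s ∈ Ioo a b := ⟨hsab.1, lt_of_le_of_ne hsab.2 hsb⟩
  have hsI' : (s, X s) ∈ Icc a b ×ˢ (univ : Set E) := ⟨Ioo_subset_Icc_self hsI, mem_univ _⟩
  have hWat : HasFDerivAt W (W' (s, X s)) (s, X s) :=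
    (hW _ hsI').hasFDerivAt (prod_mem_nhds (Icc_mem_nhds hsI.1 hsI.2) Filter.univ_mem)
  exact ((hWat.comp_hasDerivAt s ((hasDerivAt_id s).prodMk (hs hsI))).deriv).symm

end ChainRule

/-! ### Local existence for Lipschitz equations -/

section LocalExistence

variable {E : Type*} [NormedAddCommGroup E] [NormedSpace ℝ E] [CompleteSpace E]

/-- Existence of solutions of a globally Lipschitz differential equation, on intervals whose length
depends only on the Lipschitz constant. -/
theorem exists_solution_of_lipschitz {f : ℝ → E → E} {a b : ℝ} (hab : a ≤ b) {K : NNReal}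
    (hlip : ∀ t ∈ Icc a b, LipschitzWith K (f t))
    (hcont : ContinuousOn (fun p : ℝ × E => f p.1 p.2) (Icc a b ×ˢ univ))
    (hK : K * (b - a) ≤ 1 / 2) (x : E) :
    ∃ X : ℝ → E, ContinuousOn X (Icc a b) ∧
      ∀ s ∈ Icc a b, X s = x + ∫ r in a..s, f r (X r) := by
  have hc : ∀ Y : ℝ → E, ContinuousOn Y (Icc a b) →
      ContinuousOn (fun t => f t (Y t)) (Icc a b) := fun Y hY =>
    hcont.comp (f := fun t => (t, Y t)) (continuousOn_id.prodMk hY) fun t ht => ⟨ht, mem_univ _⟩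
  obtain ⟨M₀, hM₀⟩ := isCompact_Icc.exists_bound_of_continuousOn (hc _ (continuousOn_const (c := x)))
  set M : NNReal := Real.toNNReal M₀
  have hM : ∀ t ∈ Icc a b, ‖f t x‖ ≤ M := fun t ht => (hM₀ t ht).trans (Real.le_coe_toNNReal M₀)
  set h : NNReal := ⟨b - a, sub_nonneg.2 hab⟩ with hh
  have hhc : (h : ℝ) = b - a := rfl
  -- On the ball of radius `ρ` the speed is at most `M + K ρ`. Picard–Lindelöf needs `(M + K ρ) h ≤
  -- ρ`, which this `ρ` satisfies because `K h ≤ 1 / 2`.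
  set ρ : NNReal := 2 * M * h with hρ
  have hpl : IsPicardLindelof f (tmin := a) (tmax := b) ⟨a, left_mem_Icc.2 hab⟩ x ρ 0
      (M + K * ρ) K := by
    refine ⟨fun t ht => (hlip t ht).lipschitzOnWith, fun y _ => hc _ continuousOn_const,
      fun t ht y hy => ?_, ?_⟩
    · have h1 := (hlip t ht).dist_le_mul y x
      rw [dist_eq_norm, dist_eq_norm] at h1
      have h2 : ‖y - x‖ ≤ ρ := by simpa [dist_eq_norm] using hy
      have h3 := norm_le_norm_add_norm_sub' (f t y) (f t x)
      have h4 := hM t ht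
      push_cast
      have : (K : ℝ) * ‖y - x‖ ≤ K * ρ := by gcongr
      linarith
    · have h5 : max (b - a) (a - a) = (h : ℝ) := by
        rw [sub_self, max_eq_left (sub_nonneg.2 hab), hhc]
      simp only [h5]
      rw [← hhc] at hK
      rw [hρ]
      push_cast
      nlinarith [mul_le_mul_of_nonneg_left hK (show (0 : ℝ) ≤ 2 * M * h by positivity)]
  obtain ⟨X, hXa, hX⟩ := hpl.exists_eq_forall_mem_Icc_hasDerivWithinAt₀
  have hXc : ContinuousOn X (Icc a b) := fun s hs => (hX s hs).continuousWithinAt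
  refine ⟨X, hXc, fun s hs => ?_⟩
  have hsub : Icc a s ⊆ Icc a b := Icc_subset_Icc_right hs.2
  rw [intervalIntegral.integral_eq_sub_of_hasDerivAt_of_le hs.1 (hXc.mono hsub)]
  · simp only at hXa; rw [hXa]; abel
  · intro r hr
    exact (hX r (hsub (Ioo_subset_Icc_self hr))).hasDerivAt
      (Icc_mem_nhds hr.1 (hr.2.trans_le hs.2))
  · refine ContinuousOn.intervalIntegrable ?_
    rw [uIcc_of_le hs.1]
    exact (hc X hXc).mono hsub

end LocalExistence

/-! ### Trajectories, concatenation and integrability -/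

namespace AQProblem

variable {n m : ℕ} {D : AQProblem n m}

variable (D) in
/-- The velocity of the state under the control value `u`. -/
def velocity (s : ℝ) (x : Euc n) (u : Euc m) : Euc n := D.A s x + D.B s x u

variable (D) in
/-- The running cost of the control value `u`. -/
def running (s : ℝ) (x : Euc n) (u : Euc m) : ℝ :=
  D.Q s x + inner ℝ (D.S s x) u + 1 / 2 * inner ℝ (D.R s x u) u

variable (D) in
/-- `X` is the trajectory on `[a, b]` that starts from `x` under the square integrable control
`u`. -/
def IsPathOn (a b : ℝ) (x : Euc n) (X : ℝ → Euc n) (u : ℝ → Euc m) : Prop :=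
  MemLp u 2 (volume.restrict (Icc a b)) ∧ ContinuousOn X (Icc a b) ∧
    IntegrableOn (fun r => D.velocity r (X r) (u r)) (Icc a b) ∧
    ∀ s ∈ Icc a b, X s = x + ∫ r in a..s, D.velocity r (X r) (u r)

theorem IsPathOn.mono {a b c : ℝ} {x : Euc n} {X : ℝ → Euc n} {u : ℝ → Euc m}
    (h : D.IsPathOn a b x X u) (hc : c ≤ b) : D.IsPathOn a c x X u :=
  have hsub : Icc a c ⊆ Icc a b := Icc_subset_Icc_right hc
  ⟨h.1.mono_measure (Measure.restrict_mono hsub le_rfl), h.2.1.mono hsub, h.2.2.1.mono_set hsub,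
    fun s hs => h.2.2.2 s (hsub hs)⟩

theorem IsPathOn.apply_left {a b : ℝ} {x : Euc n} {X : ℝ → Euc n} {u : ℝ → Euc m}
    (h : D.IsPathOn a b x X u) (hab : a ≤ b) : X a = x := by
  simpa using h.2.2.2 a (left_mem_Icc.2 hab)

theorem IsPathOn.intervalIntegrable {a b : ℝ} {x : Euc n} {X : ℝ → Euc n} {u : ℝ → Euc m}
    (h : D.IsPathOn a b x X u) (hab : a ≤ b) :
    IntervalIntegrable (fun r => D.velocity r (X r) (u r)) volume a b := by
  rw [intervalIntegrable_iff_integrableOn_Icc_of_le hab]; exact h.2.2.1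

/-- Switching controls at time `b` serves both to continue solutions globally and to build
competitors for dynamic programming. -/
theorem IsPathOn.concat {a b c : ℝ} {x : Euc n} {X Y : ℝ → Euc n} {u v : ℝ → Euc m}
    (hab : a ≤ b) (hbc : b ≤ c) (h : D.IsPathOn a b x X u) (h' : D.IsPathOn b c (X b) Y v) :
    D.IsPathOn a c x (fun s => if s ≤ b then X s else Y s) (fun s => if s ≤ b then u s else v s) := by
  have hYb : Y b = X b := h'.apply_left hbc
  set Z : ℝ → Euc n := fun s => if s ≤ b then X s else Y s with hZ
  set w : ℝ → Euc m := fun s => if s ≤ b then u s else v s with hw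
  have hunion : Icc a b ∪ Ioc b c = Icc a c := Icc_union_Ioc_eq_Icc hab hbc
  have hZl : EqOn Z X (Icc a b) := fun s hs => if_pos hs.2
  have hZr : EqOn Z Y (Icc b c) := by
    intro s hs
    rcases eq_or_lt_of_le hs.1 with rfl | hlt
    · simp [hZ, hYb]
    · exact if_neg (not_le.2 hlt)
  have hl : EqOn (fun r => D.velocity r (Z r) (w r)) (fun r => D.velocity r (X r) (u r))
      (Icc a b) := by
    intro s hs; simp [hZ, hw, hs.2]
  have hr : EqOn (fun r => D.velocity r (Z r) (w r)) (fun r => D.velocity r (Y r) (v r))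
      (Ioc b c) := by
    intro s hs; simp [hZ, hw, not_le.2 hs.1]
  have hil : IntegrableOn (fun r => D.velocity r (Z r) (w r)) (Icc a b) :=
    h.2.2.1.congr_fun hl.symm measurableSet_Icc
  -- The interval is open at `b` because the glued control takes the value of `u` there, not of `v`.
  have hir : IntegrableOn (fun r => D.velocity r (Z r) (w r)) (Ioc b c) :=
    (h'.2.2.1.mono_set Ioc_subset_Icc_self).congr_fun hr.symm measurableSet_Ioc
  refine ⟨?_, ?_, ?_, ?_⟩
  · have hp := MemLp.piecewise (μ := volume.restrict (Icc a c)) (s := Iic b) (f := u) (g := v)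
      (p := 2) measurableSet_Iic ?_ ?_
    · exact hp
    · rw [Measure.restrict_restrict measurableSet_Iic]
      have hsub : Iic b ∩ Icc a c ⊆ Icc a b := fun s hs => ⟨hs.2.1, hs.1⟩
      exact h.1.mono_measure (Measure.restrict_mono hsub le_rfl)
    · rw [Measure.restrict_restrict measurableSet_Iic.compl]
      have hsub : (Iic b)ᶜ ∩ Icc a c ⊆ Icc b c := fun s hs =>
        ⟨(lt_of_not_ge (mt mem_Iic.2 hs.1)).le, hs.2.2⟩
      exact h'.1.mono_measure (Measure.restrict_mono hsub le_rfl)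
  · rw [← Icc_union_Icc_eq_Icc hab hbc]
    exact (h.2.1.congr hZl).union_of_isClosed (h'.2.1.congr hZr) isClosed_Icc isClosed_Icc
  · rw [← hunion]; exact hil.union hir
  · have hlint : ∀ s ∈ Icc a b, ∫ r in a..s, D.velocity r (Z r) (w r)
        = ∫ r in a..s, D.velocity r (X r) (u r) := fun s hs =>
      intervalIntegral.integral_congr fun r hr => hl (by
        rw [uIcc_of_le hs.1] at hr; exact ⟨hr.1, hr.2.trans hs.2⟩)
    intro s hs
    rcases le_or_gt s b with hsb | hsb
    · rw [hlint s ⟨hs.1, hsb⟩, hZl ⟨hs.1, hsb⟩, h.2.2.2 s ⟨hs.1, hsb⟩]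
    · have hi1 : IntervalIntegrable (fun r => D.velocity r (Z r) (w r)) volume a b := by
        rw [intervalIntegrable_iff_integrableOn_Icc_of_le hab]; exact hil
      have hi2 : IntervalIntegrable (fun r => D.velocity r (Z r) (w r)) volume b s := by
        rw [intervalIntegrable_iff_integrableOn_Ioc_of_le hsb.le]
        exact hir.mono_set (Ioc_subset_Ioc_right hs.2)
      have hrint : ∫ r in b..s, D.velocity r (Z r) (w r)
          = ∫ r in b..s, D.velocity r (Y r) (v r) := by
        refine intervalIntegral.integral_congr_ae (Filter.Eventually.of_forall fun r hrs => hr ?_)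
        rw [uIoc_of_le hsb.le] at hrs
        exact ⟨hrs.1, hrs.2.trans hs.2⟩
      rw [← intervalIntegral.integral_add_adjacent_intervals hi1 hi2, hrint,
        hlint b (right_mem_Icc.2 hab), hZr ⟨hsb.le, hs.2⟩, h'.2.2.2 s ⟨hsb.le, hs.2⟩,
        h.2.2.2 b (right_mem_Icc.2 hab), add_assoc]

theorem continuousOn_along {F : Type*} [TopologicalSpace F] {f : ℝ → Euc n → F}
    (hf : ContinuousOn (fun p : ℝ × Euc n => f p.1 p.2) D.dom) {a b : ℝ} (ha : 0 ≤ a) (hb : b ≤ D.T)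
    {X : ℝ → Euc n} (hX : ContinuousOn X (Icc a b)) :
    ContinuousOn (fun s => f s (X s)) (Icc a b) :=
  hf.comp (f := fun s => (s, X s)) (continuousOn_id.prodMk hX)
    fun _ hs => ⟨⟨ha.trans hs.1, hs.2.trans hb⟩, mem_univ _⟩

/-- Along a continuous curve, a continuous family of linear maps, applied to an integrable control,
is integrable. -/
theorem integrableOn_clm_apply {E F : Type*} [NormedAddCommGroup E] [NormedSpace ℝ E]
    [NormedAddCommGroup F] [NormedSpace ℝ F] {a b : ℝ} {M : ℝ → E →L[ℝ] F}
    (hM : ContinuousOn M (Icc a b)) {u : ℝ → E} (hu : IntegrableOn u (Icc a b))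
    [SecondCountableTopologyEither ℝ (E →L[ℝ] F)] :
    IntegrableOn (fun s => M s (u s)) (Icc a b) := by
  obtain ⟨C, hC⟩ := isCompact_Icc.exists_bound_of_continuousOn hM
  refine Integrable.mono' (hu.norm.const_mul C) ?_ ?_
  · exact isBoundedBilinearMap_apply.continuous.comp_aestronglyMeasurable
      ((hM.aestronglyMeasurable measurableSet_Icc).prodMk hu.aestronglyMeasurable)
  · filter_upwards [ae_restrict_mem measurableSet_Icc] with s hs
    exact ((M s).le_opNorm _).trans (mul_le_mul_of_nonneg_right (hC s hs) (norm_nonneg _))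

theorem integrableOn_of_memLp_two {E : Type*} [NormedAddCommGroup E] {a b : ℝ} {u : ℝ → E}
    (hu : MemLp u 2 (volume.restrict (Icc a b))) : IntegrableOn u (Icc a b) :=
  hu.integrable (by norm_num)

theorem integrableOn_quadratic {E : Type*} [NormedAddCommGroup E] [InnerProductSpace ℝ E]
    {a b : ℝ} {M : ℝ → E →L[ℝ] E}
    (hM : ContinuousOn M (Icc a b)) {u : ℝ → E} (hu : MemLp u 2 (volume.restrict (Icc a b))) :
    IntegrableOn (fun s => (inner ℝ (M s (u s)) (u s) : ℝ)) (Icc a b) := by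
  obtain ⟨C, hC⟩ := isCompact_Icc.exists_bound_of_continuousOn hM
  have hu2 : Integrable (fun s => ‖u s‖ ^ 2) (volume.restrict (Icc a b)) :=
    (memLp_two_iff_integrable_sq_norm hu.1).1 hu
  refine Integrable.mono' (hu2.const_mul C) ?_ ?_
  · exact (isBoundedBilinearMap_apply.continuous.comp_aestronglyMeasurable
      ((hM.aestronglyMeasurable measurableSet_Icc).prodMk hu.1)).inner hu.1
  · filter_upwards [ae_restrict_mem measurableSet_Icc] with s hs
    calc ‖(inner ℝ (M s (u s)) (u s) : ℝ)‖ ≤ ‖M s (u s)‖ * ‖u s‖ := norm_inner_le_norm _ _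
      _ ≤ ‖M s‖ * ‖u s‖ * ‖u s‖ := by gcongr; exact (M s).le_opNorm _
      _ ≤ C * ‖u s‖ * ‖u s‖ := by gcongr; exact hC s hs
      _ = C * ‖u s‖ ^ 2 := by ring

theorem integrableOn_running (h2 : D.H2) {a b : ℝ} (ha : 0 ≤ a) (hb : b ≤ D.T) {X : ℝ → Euc n}
    {u : ℝ → Euc m} (hX : ContinuousOn X (Icc a b)) (hu : MemLp u 2 (volume.restrict (Icc a b))) :
    IntegrableOn (fun s => D.running s (X s) (u s)) (Icc a b) := by
  have hS := (innerSL ℝ (E := Euc m)).continuous.comp_continuousOn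
    (continuousOn_along h2.2.1 ha hb hX)
  exact ((continuousOn_along h2.1 ha hb hX).integrableOn_Icc.add
    (integrableOn_clm_apply hS (integrableOn_of_memLp_two hu))).add
    ((integrableOn_quadratic (continuousOn_along h2.2.2.1 ha hb hX) hu).const_mul _)

theorem intervalIntegrable_running (h2 : D.H2) {a b : ℝ} (ha : 0 ≤ a) (hab : a ≤ b) (hb : b ≤ D.T)
    {x : Euc n} {X : ℝ → Euc n} {u : ℝ → Euc m} (h : D.IsPathOn a b x X u) :
    IntervalIntegrable (fun s => D.running s (X s) (u s)) volume a b := by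
  rw [intervalIntegrable_iff_integrableOn_Icc_of_le hab]
  exact integrableOn_running h2 ha hb h.2.1 h.1

/-- Every constant control has a trajectory. -/
theorem exists_isPathOn_const (h1 : D.H1) (c : Euc m) {t : ℝ} (ht : t ∈ Icc 0 D.T) (x : Euc n) :
    ∃ X, D.IsPathOn t D.T x X (fun _ => c) := by
  obtain ⟨hA, hB, LA, LB, LB', hLA, hLB, hLB', hlA, hlB, -⟩ := h1
  set K : NNReal := ⟨LA + LB' * ‖c‖, by positivity⟩ with hKdef
  have hKc : (K : ℝ) = LA + LB' * ‖c‖ := rfl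
  have hKpos : 0 < (K : ℝ) := by rw [hKc]; positivity
  have hlip : ∀ s ∈ Icc 0 D.T, LipschitzWith K (fun y => D.velocity s y c) := by
    intro s hs
    refine LipschitzWith.of_dist_le_mul fun y z => ?_
    rw [dist_eq_norm, dist_eq_norm, hKc]
    have e : D.velocity s y c - D.velocity s z c = (D.A s y - D.A s z) + (D.B s y - D.B s z) c := by
      simp [velocity]; abel
    rw [e]
    have h3 := ((D.B s y - D.B s z).le_opNorm c).trans
      (mul_le_mul_of_nonneg_right (hlB s hs y z) (norm_nonneg c))
    refine (norm_add_le _ _).trans ((add_le_add (hlA s hs y z) h3).trans (le_of_eq (by ring)))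
  have hcont : ContinuousOn (fun p : ℝ × Euc n => D.velocity p.1 p.2 c) D.dom :=
    hA.add (hB.clm_apply continuousOn_const)
  -- The local step length is independent of the initial state, so finitely many steps reach `D.T`.
  set h : ℝ := 1 / (2 * K) with hh
  have hhpos : 0 < h := by positivity
  have main : ∀ N : ℕ, ∀ t ∈ Icc 0 D.T, D.T - t ≤ N * h → ∀ x : Euc n,
      ∃ X, D.IsPathOn t D.T x X (fun _ => c) := by
    intro N
    have local_exists : ∀ a b : ℝ, 0 ≤ a → a ≤ b → b ≤ D.T → b - a ≤ h → ∀ x : Euc n,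
        ∃ X, D.IsPathOn a b x X (fun _ => c) := by
      intro a b ha hab hb hba x
      have hsub : Icc a b ⊆ Icc 0 D.T := Icc_subset_Icc ha hb
      obtain ⟨X, hXc, hX⟩ := exists_solution_of_lipschitz (f := fun s y => D.velocity s y c) hab
        (fun s hs => hlip s (hsub hs)) (hcont.mono (prod_mono_left hsub))
        (by
          calc (K : ℝ) * (b - a) ≤ K * h := by gcongr
            _ = 1 / 2 := by rw [hh]; field_simp) x
      exact ⟨X, memLp_const c, hXc,
        (continuousOn_along (f := fun s y => D.velocity s y c) hcont ha hb hXc).integrableOn_Icc, hX⟩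
    induction N with
    | zero =>
      intro t ht hle x
      exact local_exists t D.T ht.1 ht.2 le_rfl
        (by simp only [Nat.cast_zero, zero_mul] at hle; linarith) x
    | succ N ih =>
      intro t ht hle x
      rcases le_total D.T (t + h) with hc | hc
      · exact local_exists t D.T ht.1 ht.2 le_rfl (by linarith) x
      · obtain ⟨X, hX⟩ := local_exists t (t + h) ht.1 (by linarith) hc (by linarith) x
        obtain ⟨Y, hY⟩ := ih (t + h) ⟨by linarith [ht.1], hc⟩ (by push_cast at hle; linarith)
          (X (t + h))
        exact ⟨_, by simpa using hX.concat (by linarith) hc hY⟩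
  obtain ⟨N, hN⟩ := exists_nat_ge ((D.T - t) / h)
  exact main N t ht ((div_le_iff₀ hhpos).1 hN) x

end AQProblem

/-! ### Coercivity and lower bounds for the cost -/

/-- Coercivity forces injectivity, which suffices in finite dimension. Thus `inverse` in the
hypotheses is a true inverse and not the default value zero. -/
theorem ContinuousLinearMap.isInvertible_of_coercive {E : Type*} [NormedAddCommGroup E]
    [InnerProductSpace ℝ E] [FiniteDimensional ℝ E] {R : E →L[ℝ] E} {c : ℝ} (hc : 0 < c)
    (h : ∀ u, c * ‖u‖ ^ 2 ≤ inner ℝ (R u) u) : R.IsInvertible := by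
  have hinj : Function.Injective R.toLinearMap := by
    rw [injective_iff_map_eq_zero]
    intro u hu
    have h1 := h u
    rw [show R u = 0 from hu, inner_zero_left] at h1
    have h2 : ‖u‖ ^ 2 ≤ 0 := nonpos_of_mul_nonpos_right h1 hc
    exact norm_eq_zero.1 (pow_eq_zero_iff two_ne_zero |>.1 (le_antisymm h2 (sq_nonneg _)))
  exact ⟨(LinearEquiv.ofInjectiveEndo R.toLinearMap hinj).toContinuousLinearEquiv, by ext1; rfl⟩

theorem ContinuousLinearMap.IsInvertible.apply_inverse {E : Type*} [NormedAddCommGroup E]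
    [NormedSpace ℝ E] {R : E →L[ℝ] E} (h : R.IsInvertible) (v : E) : R (R.inverse v) = v := by
  obtain ⟨e, rfl⟩ := h
  simp

namespace AQProblem

variable {n m : ℕ} {D : AQProblem n m}

theorem H2.exists_coercive (h2 : D.H2) :
    ∃ c > 0, ∀ t ∈ Icc 0 D.T, ∀ (x : Euc n) (u : Euc m),
      c * ‖u‖ ^ 2 ≤ inner ℝ (D.R t x u) u := by
  obtain ⟨-, -, -, -, -, L, Q₀, G₀, S₀, ε₀, ρ₀, ρ, -, -, -, -, -, -, hρ₀, -, hρ, -, -, h⟩ := h2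
  exact ⟨ρ₀, hρ₀, fun t ht x u =>
    (mul_le_mul_of_nonneg_right (hρ x) (sq_nonneg _)).trans ((h t ht x).1 u)⟩

theorem H2.isInvertible (h2 : D.H2) {t : ℝ} (ht : t ∈ Icc 0 D.T) (x : Euc n) :
    (D.R t x).IsInvertible := by
  obtain ⟨c, hc, h⟩ := h2.exists_coercive
  exact ContinuousLinearMap.isInvertible_of_coercive hc (h t ht x)

theorem H2.inner_R_comm (h2 : D.H2) {t : ℝ} (ht : t ∈ Icc 0 D.T) (x : Euc n) (u v : Euc m) :
    inner ℝ (D.R t x u) v = inner ℝ u (D.R t x v) := by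
  rw [← ContinuousLinearMap.adjoint_inner_right, (h2.2.2.2.2.1 t ht x).adjoint_eq]

/-- Completing the square in a quadratic form. -/
theorem H2.inner_R_add (h2 : D.H2) {t : ℝ} (ht : t ∈ Icc 0 D.T) (x : Euc n) (u v : Euc m) :
    inner ℝ (D.R t x (u + v)) (u + v)
      = inner ℝ (D.R t x u) u + 2 * inner ℝ (D.R t x v) u + inner ℝ (D.R t x v) v := by
  have h : inner ℝ (D.R t x u) v = inner ℝ (D.R t x v) u := by
    rw [h2.inner_R_comm ht, real_inner_comm]
  simp only [map_add, inner_add_left, inner_add_right, h]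
  ring

/-- The assumed bound on `Q` absorbs the term linear in `u` using only the fraction `1 - ε₀` of the
quadratic term; the remaining fraction `ε₀` controls `‖u‖ ^ 2`. -/
theorem H2.exists_running_lower_bound (h2 : D.H2) :
    ∃ κ > 0, ∃ C ≥ 0, ∀ t ∈ Icc 0 D.T, ∀ (x : Euc n) (u : Euc m),
      κ * ‖u‖ ^ 2 - C ≤ D.running t x u := by
  obtain ⟨-, -, -, -, -, L, Q₀, G₀, S₀, ε₀, ρ₀, ρ, hL, -, -, -, hε, hε1, hρ₀, -, hρ, -, -, h⟩ :=
    id h2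
  have hδ : 0 < 1 - ε₀ := by linarith
  refine ⟨ε₀ * ρ₀ / 2, by positivity, L / (1 - ε₀), by positivity, fun t ht x u => ?_⟩
  obtain ⟨h3, h4, -⟩ := h t ht x
  have hru : ρ₀ * ‖u‖ ^ 2 ≤ inner ℝ (D.R t x u) u :=
    (mul_le_mul_of_nonneg_right (hρ x) (sq_nonneg _)).trans (h3 u)
  set w := (D.R t x).inverse (D.S t x) with hw
  have hRw : D.R t x w = D.S t x := (h2.isInvertible ht x).apply_inverse _
  -- This is the square to be completed: half of its expansion, added to the bound on `(1 - ε₀) Q`,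
  -- cancels the term `⟨S, R⁻¹ S⟩`.
  have h5 : 0 ≤ inner ℝ (D.R t x ((1 - ε₀) • u + w)) ((1 - ε₀) • u + w) :=
    le_trans (by positivity) (mul_le_mul_of_nonneg_right (hρ x) (sq_nonneg _) |>.trans (h3 _))
  rw [h2.inner_R_add ht, hRw] at h5
  simp only [map_smul, inner_smul_left, inner_smul_right, RCLike.conj_to_real] at h5
  have h6 : ε₀ * (ρ₀ * ‖u‖ ^ 2) ≤ ε₀ * inner ℝ (D.R t x u) u := by gcongr
  have h7 : 0 ≤ (1 - ε₀) * (D.Q t x + inner ℝ (D.S t x) u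
      + 1 / 2 * ((1 - ε₀) * inner ℝ (D.R t x u) u)) + L := by nlinarith
  have h8 : -(L / (1 - ε₀)) ≤ D.Q t x + inner ℝ (D.S t x) u
      + 1 / 2 * ((1 - ε₀) * inner ℝ (D.R t x u) u) := by
    rw [neg_le_iff_add_nonneg, ← mul_nonneg_iff_of_pos_left hδ, mul_add, mul_div_cancel₀ _ hδ.ne']
    exact h7
  simp only [running]
  linarith

/-- Besides bounding the cost below, this turns a bound on the cost into a bound on the energy of
the control. -/
theorem H2.exists_cost_lower_bound (h2 : D.H2) :
    ∃ κ > 0, ∃ C : ℝ, ∀ t ∈ Icc 0 D.T, ∀ (x : Euc n) (X : ℝ → Euc n) (u : ℝ → Euc m),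
      D.IsPathOn t D.T x X u → κ * (∫ s in t..D.T, ‖u s‖ ^ 2) - C ≤ D.cost t X u := by
  obtain ⟨κ, hκ, C, hC, h⟩ := h2.exists_running_lower_bound
  obtain ⟨-, -, -, -, -, L, Q₀, G₀, S₀, ε₀, ρ₀, ρ, hL, -, -, -, -, -, -, -, -, hG, -, -⟩ := id h2
  refine ⟨κ, hκ, C * D.T + L, fun t ht x X u hX => ?_⟩
  have hu2 : IntervalIntegrable (fun s => ‖u s‖ ^ 2) volume t D.T := by
    rw [intervalIntegrable_iff_integrableOn_Icc_of_le ht.2]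
    exact (memLp_two_iff_integrable_sq_norm hX.1.1).1 hX.1
  have h1 : ∫ s in t..D.T, (κ * ‖u s‖ ^ 2 - C) ≤ ∫ s in t..D.T, D.running s (X s) (u s) :=
    intervalIntegral.integral_mono_on ht.2 ((hu2.const_mul κ).sub intervalIntegrable_const)
      (intervalIntegrable_running h2 ht.1 ht.2 le_rfl hX)
      fun s hs => h s ⟨ht.1.trans hs.1, hs.2⟩ _ _
  rw [intervalIntegral.integral_sub (hu2.const_mul κ) intervalIntegrable_const,
    intervalIntegral.integral_const_mul, intervalIntegral.integral_const, smul_eq_mul] at h1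
  have h3 : (D.T - t) * C ≤ C * D.T := by nlinarith [ht.1]
  have h4 := hG (X D.T)
  change _ ≤ (∫ s in t..D.T, D.running s (X s) (u s)) + D.G (X D.T)
  linarith

theorem H2.bddBelow_costs (h2 : D.H2) {t : ℝ} (ht : t ∈ Icc 0 D.T) (x : Euc n) :
    BddBelow {c : ℝ | ∃ (X : ℝ → Euc n) (u : ℝ → Euc m),
      D.IsAdmissiblePair t x X u ∧ c = D.cost t X u} := by
  obtain ⟨κ, hκ, C, h⟩ := h2.exists_cost_lower_bound
  refine ⟨-C, ?_⟩
  rintro _ ⟨X, u, hX, rfl⟩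
  have h1 := h t ht x X u hX
  have h3 : 0 ≤ κ * ∫ s in t..D.T, ‖u s‖ ^ 2 :=
    mul_nonneg hκ.le (intervalIntegral.integral_nonneg ht.2 fun s _ => sq_nonneg _)
  linarith

/-! ### The value function and dynamic programming -/

theorem value_le_cost (h2 : D.H2) {t : ℝ} (ht : t ∈ Icc 0 D.T) {x : Euc n} {X : ℝ → Euc n}
    {u : ℝ → Euc m} (hX : D.IsPathOn t D.T x X u) : D.value t x ≤ D.cost t X u :=
  -- On `[t, D.T]`, `IsPathOn` unfolds to `IsAdmissiblePair`, so `hX` serves as is.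
  csInf_le (h2.bddBelow_costs ht x) ⟨X, u, hX, rfl⟩

theorem exists_cost_lt (h1 : D.H1) {t : ℝ} (ht : t ∈ Icc 0 D.T) (x : Euc n) {ε : ℝ}
    (hε : 0 < ε) : ∃ X u, D.IsPathOn t D.T x X u ∧ D.cost t X u < D.value t x + ε := by
  obtain ⟨X₀, hX₀⟩ := exists_isPathOn_const h1 (0 : Euc m) ht x
  obtain ⟨_, ⟨X, u, hX, rfl⟩, hlt⟩ :=
    exists_lt_of_csInf_lt (s := {c : ℝ | ∃ (X : ℝ → Euc n) (u : ℝ → Euc m),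
      D.IsAdmissiblePair t x X u ∧ c = D.cost t X u}) ⟨_, X₀, _, hX₀, rfl⟩
      (lt_add_of_pos_right (D.value t x) hε)
  exact ⟨X, u, hX, hlt⟩

/-- One half of the dynamic programming principle. -/
theorem value_le_integral_running_add_value (h1 : D.H1) (h2 : D.H2) {a b : ℝ} (ha : 0 ≤ a)
    (hab : a ≤ b) (hb : b ≤ D.T) {x : Euc n} {X : ℝ → Euc n} {u : ℝ → Euc m}
    (hX : D.IsPathOn a b x X u) :
    D.value a x ≤ (∫ s in a..b, D.running s (X s) (u s)) + D.value b (X b) := by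
  refine le_of_forall_pos_le_add fun ε hε => ?_
  -- An `ε`-optimal continuation from `(b, X b)`, glued to the given path, competes in the infimum
  -- at `(a, x)`.
  obtain ⟨Y, v, hY, hlt⟩ := exists_cost_lt h1 ⟨ha.trans hab, hb⟩ (X b) hε
  have hYb := hY.apply_left hb
  have hc := hX.concat hab hb hY
  have hle := value_le_cost h2 ⟨ha, hab.trans hb⟩ hc
  -- If `b = D.T` the glued path follows `X` at the final time, which agrees with `Y` there.
  have hZT : (if D.T ≤ b then X D.T else Y D.T) = Y D.T := by
    split_ifs with h
    · rw [le_antisymm hb h] at hYb; exact hYb.symm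
    · rfl
  have hint := intervalIntegrable_running h2 ha (hab.trans hb) le_rfl hc
  have hcost : D.cost a (fun s => if s ≤ b then X s else Y s) (fun s => if s ≤ b then u s else v s)
      = (∫ s in a..b, D.running s (X s) (u s)) + D.cost b Y v := by
    change (∫ s in a..D.T, D.running s (if s ≤ b then X s else Y s) (if s ≤ b then u s else v s))
        + D.G (if D.T ≤ b then X D.T else Y D.T)
      = _ + ((∫ s in b..D.T, D.running s (Y s) (v s)) + D.G (Y D.T))
    rw [hZT, ← add_assoc, ← intervalIntegral.integral_add_adjacent_intervals (b := b)
      (hint.mono_set (uIcc_subset_uIcc left_mem_uIcc (by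
        rw [uIcc_of_le (hab.trans hb)]; exact ⟨hab, hb⟩)))
      (hint.mono_set (uIcc_subset_uIcc (by
        rw [uIcc_of_le (hab.trans hb)]; exact ⟨hab, hb⟩) right_mem_uIcc))]
    congr 2
    · refine intervalIntegral.integral_congr fun s hs => ?_
      rw [uIcc_of_le hab] at hs
      simp [hs.2]
    · refine intervalIntegral.integral_congr_ae (Filter.Eventually.of_forall fun s hs => ?_)
      rw [uIoc_of_le hb] at hs
      simp [not_le.2 hs.1]
  linarith

theorem value_terminal (h1 : D.H1) (x : Euc n) : D.value D.T x = D.G x := by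
  have hT : D.T ∈ Icc 0 D.T := right_mem_Icc.2 D.T_pos.le
  have hcost : ∀ X u, D.IsPathOn D.T D.T x X u → D.cost D.T X u = D.G x := by
    intro X u hX
    simp [cost, hX.apply_left le_rfl]
  have hset : {c : ℝ | ∃ (X : ℝ → Euc n) (u : ℝ → Euc m),
      D.IsAdmissiblePair D.T x X u ∧ c = D.cost D.T X u} = {D.G x} := by
    ext c
    constructor
    · rintro ⟨X, u, hX, rfl⟩
      exact hcost X u hX
    · rintro rfl
      obtain ⟨X, hX⟩ := exists_isPathOn_const h1 (0 : Euc m) hT x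
      exact ⟨X, _, hX, (hcost X _ hX).symm⟩
  rw [value, hset, csInf_singleton]

/-! ### The Hamiltonian and its minimum -/

variable (D) in
/-- The derivative of the value function on `[0, T] × ℝⁿ`. -/
def valueDeriv (p : ℝ × Euc n) : ℝ × Euc n →L[ℝ] ℝ :=
  fderivWithin ℝ (fun p : ℝ × Euc n => D.value p.1 p.2) D.dom p

variable (D) in
/-- The rate of change of the value function plus running cost, under the control value `u`. -/
def hamiltonian (s : ℝ) (x : Euc n) (u : Euc m) : ℝ :=
  D.valueDeriv (s, x) (1, D.velocity s x u) + D.running s x u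

variable (D) in
/-- The coefficient of the control value in the Hamiltonian. -/
def switching (s : ℝ) (x : Euc n) : Euc m :=
  ContinuousLinearMap.adjoint (D.B s x) (gradient (D.value s) x) + D.S s x

variable (D) in
/-- The minimizer of the Hamiltonian. -/
def feedback (s : ℝ) (x : Euc n) : Euc m := -(D.R s x).inverse (D.switching s x)

variable (D) in
/-- The minimum of the Hamiltonian, i.e. the left-hand side of the Hamilton–Jacobi–Bellman
equation. -/
def minHamiltonian (s : ℝ) (x : Euc n) : ℝ :=
  D.valueDeriv (s, x) (1, D.A s x) + D.Q s x
    - 1 / 2 * inner ℝ (D.switching s x) ((D.R s x).inverse (D.switching s x))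

theorem TwiceDifferentiable.hasFDerivWithinAt (hV : D.TwiceDifferentiable D.value) {p : ℝ × Euc n}
    (hp : p ∈ D.dom) :
    HasFDerivWithinAt (fun p : ℝ × Euc n => D.value p.1 p.2) (D.valueDeriv p) D.dom p :=
  (hV.1 p hp).hasFDerivWithinAt

theorem TwiceDifferentiable.continuousOn (hV : D.TwiceDifferentiable D.value) :
    ContinuousOn D.valueDeriv D.dom := hV.2.continuousOn

/-- The whole slice at time `t` lies in the domain, so space derivatives are unrestricted even at
the end times. -/
theorem hasFDerivAt_slice {F : Type*} [NormedAddCommGroup F] [NormedSpace ℝ F]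
    {f : ℝ × Euc n → F} {t : ℝ} (ht : t ∈ Icc 0 D.T) {x : Euc n} {f' : ℝ × Euc n →L[ℝ] F}
    (hf : HasFDerivWithinAt f f' D.dom (t, x)) :
    HasFDerivAt (fun y => f (t, y)) (f' ∘L ContinuousLinearMap.inr ℝ ℝ (Euc n)) x := by
  rw [← hasFDerivWithinAt_univ]
  exact hf.comp (t := D.dom) x (hasFDerivAt_prodMk_right t x).hasFDerivWithinAt
    fun y _ => ⟨ht, mem_univ _⟩

theorem TwiceDifferentiable.hasFDerivAt_slice (hV : D.TwiceDifferentiable D.value) {t : ℝ}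
    (ht : t ∈ Icc 0 D.T) (x : Euc n) :
    HasFDerivAt (D.value t) (D.valueDeriv (t, x) ∘L ContinuousLinearMap.inr ℝ ℝ (Euc n)) x :=
  AQProblem.hasFDerivAt_slice ht (hV.hasFDerivWithinAt (p := (t, x)) ⟨ht, mem_univ _⟩)

theorem TwiceDifferentiable.gradient_eq (hV : D.TwiceDifferentiable D.value) {t : ℝ}
    (ht : t ∈ Icc 0 D.T) (x : Euc n) :
    gradient (D.value t) x = (InnerProductSpace.toDual ℝ (Euc n)).symm
      (D.valueDeriv (t, x) ∘L ContinuousLinearMap.inr ℝ ℝ (Euc n)) := by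
  rw [gradient, (hV.hasFDerivAt_slice ht x).fderiv]

theorem TwiceDifferentiable.inner_gradient (hV : D.TwiceDifferentiable D.value) {t : ℝ}
    (ht : t ∈ Icc 0 D.T) (x y : Euc n) :
    inner ℝ (gradient (D.value t) x) y = D.valueDeriv (t, x) (0, y) := by
  rw [hV.gradient_eq ht, InnerProductSpace.toDual_symm_apply]
  simp

/-- The Hamiltonian is quadratic in `u`, and `R` applied to the feedback value is minus the linear
coefficient; completing the square leaves no other term in `u`. -/
theorem hamiltonian_eq (h2 : D.H2) (hV : D.TwiceDifferentiable D.value) {t : ℝ}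
    (ht : t ∈ Icc 0 D.T) (x : Euc n) (u : Euc m) :
    D.hamiltonian t x u = D.minHamiltonian t x
      + 1 / 2 * inner ℝ (D.R t x (u - D.feedback t x)) (u - D.feedback t x) := by
  have hRf : D.R t x (D.feedback t x) = - D.switching t x := by
    rw [feedback, map_neg, (h2.isInvertible ht x).apply_inverse]
  have hv : D.valueDeriv (t, x) (1, D.velocity t x u)
      = D.valueDeriv (t, x) (1, D.A t x)
        + inner ℝ (ContinuousLinearMap.adjoint (D.B t x) (gradient (D.value t) x)) u := by
    rw [ContinuousLinearMap.adjoint_inner_left, hV.inner_gradient ht, ← map_add]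
    simp [velocity]
  have hu : inner ℝ (D.R t x (u - D.feedback t x)) (u - D.feedback t x)
      = inner ℝ (D.R t x u) u + 2 * inner ℝ (D.switching t x) u
        + inner ℝ (D.switching t x) ((D.R t x).inverse (D.switching t x)) := by
    rw [sub_eq_add_neg, h2.inner_R_add ht, map_neg, hRf, neg_neg]
    congr 2
    rw [feedback, neg_neg]
  have hs : inner ℝ (D.switching t x) u
      = inner ℝ (ContinuousLinearMap.adjoint (D.B t x) (gradient (D.value t) x)) u
        + inner ℝ (D.S t x) u := inner_add_left _ _ _
  rw [hu, hamiltonian, hv, running, minHamiltonian, hs]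
  ring

theorem inner_R_nonneg (h2 : D.H2) {t : ℝ} (ht : t ∈ Icc 0 D.T) (x : Euc n) (u : Euc m) :
    0 ≤ inner ℝ (D.R t x u) u := by
  obtain ⟨c, hc, h⟩ := h2.exists_coercive
  exact le_trans (by positivity) (h t ht x u)

theorem minHamiltonian_eq (h2 : D.H2) (hV : D.TwiceDifferentiable D.value) {t : ℝ}
    (ht : t ∈ Icc 0 D.T) (x : Euc n) :
    D.minHamiltonian t x = D.hamiltonian t x (D.feedback t x) := by
  simp [hamiltonian_eq h2 hV ht]

theorem minHamiltonian_le (h2 : D.H2) (hV : D.TwiceDifferentiable D.value) {t : ℝ}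
    (ht : t ∈ Icc 0 D.T) (x : Euc n) (u : Euc m) :
    D.minHamiltonian t x ≤ D.hamiltonian t x u := by
  rw [hamiltonian_eq h2 hV ht]
  linarith [inner_R_nonneg h2 ht x (u - D.feedback t x)]

theorem continuousOn_minHamiltonian (h1 : D.H1) (h2 : D.H2) (hV : D.TwiceDifferentiable D.value) :
    ContinuousOn (fun p : ℝ × Euc n => D.minHamiltonian p.1 p.2) D.dom := by
  have hR : ContinuousOn (fun p : ℝ × Euc n => (D.R p.1 p.2).inverse) D.dom := fun p hp =>
    ContinuousAt.comp_continuousWithinAt (f := fun p : ℝ × Euc n => D.R p.1 p.2)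
      ((h2.isInvertible hp.1 p.2).contDiffAt_map_inverse (n := 0)).continuousAt (h2.2.2.1 p hp)
  have hP : ContinuousOn (fun p : ℝ × Euc n => gradient (D.value p.1) p.2) D.dom :=
    ((InnerProductSpace.toDual ℝ (Euc n)).symm.continuous.comp_continuousOn
      (hV.continuousOn.clm_comp continuousOn_const)).congr fun p hp => hV.gradient_eq hp.1 p.2
  have hadj : ContinuousOn (fun p : ℝ × Euc n => ContinuousLinearMap.adjoint (D.B p.1 p.2)) D.dom :=
    (ContinuousLinearMap.adjoint (𝕜 := ℝ) (E := Euc m) (F := Euc n)).continuous.comp_continuousOn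
      h1.2.1
  have hq : ContinuousOn (fun p : ℝ × Euc n => D.switching p.1 p.2) D.dom :=
    (hadj.clm_apply hP).add h2.2.1
  exact ((hV.continuousOn.clm_apply (continuousOn_const.prodMk h1.1)).add h2.1).sub
    (continuousOn_const.mul (hq.inner (hR.clm_apply hq)))

theorem integrableOn_valueDeriv (hV : D.TwiceDifferentiable D.value) {a b : ℝ}
    (ha : 0 ≤ a) (hb : b ≤ D.T) {x : Euc n} {X : ℝ → Euc n} {u : ℝ → Euc m}
    (hX : D.IsPathOn a b x X u) :
    IntegrableOn (fun s => D.valueDeriv (s, X s) (1, D.velocity s (X s) (u s))) (Icc a b) :=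
  integrableOn_clm_apply
    (continuousOn_along (f := fun s y => D.valueDeriv (s, y)) hV.continuousOn ha hb hX.2.1)
    (Integrable.prodMk (integrable_const _) hX.2.2.1)

theorem intervalIntegrable_valueDeriv (hV : D.TwiceDifferentiable D.value) {a b : ℝ}
    (ha : 0 ≤ a) (hab : a ≤ b) (hb : b ≤ D.T) {x : Euc n} {X : ℝ → Euc n} {u : ℝ → Euc m}
    (hX : D.IsPathOn a b x X u) :
    IntervalIntegrable (fun s => D.valueDeriv (s, X s) (1, D.velocity s (X s) (u s)))
      volume a b := by
  rw [intervalIntegrable_iff_integrableOn_Icc_of_le hab]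
  exact integrableOn_valueDeriv hV ha hb hX

theorem intervalIntegrable_hamiltonian (h2 : D.H2) (hV : D.TwiceDifferentiable D.value) {a b : ℝ}
    (ha : 0 ≤ a) (hab : a ≤ b) (hb : b ≤ D.T) {x : Euc n} {X : ℝ → Euc n} {u : ℝ → Euc m}
    (hX : D.IsPathOn a b x X u) :
    IntervalIntegrable (fun s => D.hamiltonian s (X s) (u s)) volume a b :=
  (intervalIntegrable_valueDeriv hV ha hab hb hX).add (intervalIntegrable_running h2 ha hab hb hX)

/-- The derivative of `V` along the path integrates to the increment of `V`, by the chain rule for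
absolutely continuous curves. -/
theorem integral_hamiltonian (h2 : D.H2) (hV : D.TwiceDifferentiable D.value) {a b : ℝ}
    (ha : 0 ≤ a) (hab : a ≤ b) (hb : b ≤ D.T) {x : Euc n} {X : ℝ → Euc n} {u : ℝ → Euc m}
    (hX : D.IsPathOn a b x X u) :
    ∫ s in a..b, D.hamiltonian s (X s) (u s)
      = (∫ s in a..b, D.running s (X s) (u s)) + D.value b (X b) - D.value a x := by
  have hsub : Icc a b ×ˢ (univ : Set (Euc n)) ⊆ D.dom := prod_mono_left (Icc_subset_Icc ha hb)
  have h := integral_fderiv_along_curve hab (hX.intervalIntegrable hab) hX.2.1 hX.2.2.2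
    (fun p hp => (hV.hasFDerivWithinAt (hsub hp)).mono hsub) (hV.continuousOn.mono hsub)
  simp only [hamiltonian]
  rw [intervalIntegral.integral_add (intervalIntegrable_valueDeriv hV ha hab hb hX)
    (intervalIntegrable_running h2 ha hab hb hX), h, hX.apply_left hab]
  ring

theorem cost_sub_value (h1 : D.H1) (h2 : D.H2) (hV : D.TwiceDifferentiable D.value) {t : ℝ}
    (ht : t ∈ Icc 0 D.T) {x : Euc n} {X : ℝ → Euc n} {u : ℝ → Euc m}
    (hX : D.IsPathOn t D.T x X u) :
    ∫ s in t..D.T, D.hamiltonian s (X s) (u s) = D.cost t X u - D.value t x := by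
  rw [integral_hamiltonian h2 hV ht.1 ht.2 le_rfl hX, value_terminal h1]
  rfl

/-! ### The Hamilton–Jacobi–Bellman equation -/

theorem nonneg_left_of_integral_nonneg {g : ℝ → ℝ} {a b : ℝ} (hab : a < b)
    (hg : ContinuousOn g (Icc a b)) (h : ∀ c ∈ Ioc a b, 0 ≤ ∫ s in a..c, g s) : 0 ≤ g a := by
  by_contra! hlt
  obtain ⟨δ, hδ, hd⟩ := Metric.continuousWithinAt_iff.1 (hg a (left_mem_Icc.2 hab.le)) (-g a)
    (by linarith)
  set c := min (a + δ) b with hc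
  have hac : a < c := lt_min (by linarith) hab
  have hcb : c ≤ b := min_le_right _ _
  have hpos : 0 < ∫ s in a..c, -g s := by
    refine intervalIntegral.intervalIntegral_pos_of_pos_on ?_ (fun s hs => ?_) hac
    · refine (ContinuousOn.intervalIntegrable ?_).neg
      rw [uIcc_of_le hac.le]
      exact hg.mono (Icc_subset_Icc_right hcb)
    · have h3 := hd (x := s) ⟨hs.1.le, hs.2.le.trans hcb⟩ (by
        rw [Real.dist_eq, abs_of_pos (sub_pos.2 hs.1)]
        linarith [hs.2, min_le_left (a + δ) b])
      rw [Real.dist_eq] at h3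
      linarith [le_abs_self (g s - g a)]
  rw [intervalIntegral.integral_neg] at hpos
  linarith [h c ⟨hac, hcb⟩]

/-- Under the constant control `u` the Hamiltonian is continuous in time, and dynamic programming
makes its integral over every initial interval nonnegative. Room to the right of `t` is needed,
hence `t < D.T`. -/
theorem hamiltonian_nonneg (h1 : D.H1) (h2 : D.H2) (hV : D.TwiceDifferentiable D.value) {t : ℝ}
    (ht : t ∈ Ico 0 D.T) (x : Euc n) (u : Euc m) : 0 ≤ D.hamiltonian t x u := by
  obtain ⟨X, hX⟩ := exists_isPathOn_const h1 u (Ico_subset_Icc_self ht) x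
  have hcont : ContinuousOn (fun p : ℝ × Euc n => D.hamiltonian p.1 p.2 u) D.dom :=
    (hV.continuousOn.clm_apply (continuousOn_const.prodMk
      (h1.1.add (h1.2.1.clm_apply continuousOn_const)))).add
    ((h2.1.add (h2.2.1.inner continuousOn_const)).add
      (continuousOn_const.mul ((h2.2.2.1.clm_apply continuousOn_const).inner continuousOn_const)))
  have h := nonneg_left_of_integral_nonneg ht.2
    (continuousOn_along (f := fun s y => D.hamiltonian s y u) hcont ht.1 le_rfl hX.2.1) ?_
  · simpa only [hX.apply_left ht.2.le] using h
  · intro c hc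
    have hXc := hX.mono hc.2
    rw [integral_hamiltonian h2 hV ht.1 hc.1.le hc.2 hXc]
    linarith [value_le_integral_running_add_value h1 h2 ht.1 hc.1.le hc.2 hXc]

theorem minHamiltonian_nonneg (h1 : D.H1) (h2 : D.H2) (hV : D.TwiceDifferentiable D.value) {t : ℝ}
    (ht : t ∈ Icc 0 D.T) (x : Euc n) : 0 ≤ D.minHamiltonian t x := by
  -- The final time is reached by continuity.
  have hcl := closure_Ico D.T_pos.ne
  refine le_on_closure (s := Ico 0 D.T) (f := fun _ => (0 : ℝ))
    (g := fun s => D.minHamiltonian s x) (fun s hs => ?_) continuousOn_const ?_ (hcl ▸ ht)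
  · rw [minHamiltonian_eq h2 hV (Ico_subset_Icc_self hs)]
    exact hamiltonian_nonneg h1 h2 hV hs _ _
  · rw [hcl]
    exact continuousOn_along (continuousOn_minHamiltonian h1 h2 hV) le_rfl le_rfl continuousOn_const

/-- Trajectories under controls of bounded energy stay close to their initial state for a uniform
time. -/
theorem exists_forall_norm_sub_le (h1 : D.H1) {t : ℝ} (ht : t ∈ Ico 0 D.T) (x : Euc n) {r M : ℝ}
    (hr : 0 < r) (hM : 0 ≤ M) :
    ∃ δ > 0, t + δ ≤ D.T ∧ ∀ X u, D.IsPathOn t D.T x X u → (∫ s in t..D.T, ‖u s‖ ^ 2) ≤ M →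
      ∀ s ∈ Icc t (t + δ), ‖X s - x‖ ≤ r := by
  obtain ⟨hA, hB, LA, LB, LB', hLA, hLB, hLB', hlA, hlB, -⟩ := h1
  obtain ⟨MA, hMA⟩ := isCompact_Icc.exists_bound_of_continuousOn
    (continuousOn_along hA le_rfl le_rfl (continuousOn_const (c := x)))
  obtain ⟨MB, hMB⟩ := isCompact_Icc.exists_bound_of_continuousOn
    (continuousOn_along hB le_rfl le_rfl (continuousOn_const (c := x)))
  have hMA0 : 0 ≤ MA := (norm_nonneg _).trans (hMA 0 ⟨le_rfl, D.T_pos.le⟩)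
  have hMB0 : 0 ≤ MB := (norm_nonneg _).trans (hMB 0 ⟨le_rfl, D.T_pos.le⟩)
  set N := MA + MB + LA + LB' with hN
  have hN0 : 0 < N := by positivity
  -- The constants aim at `μ ≤ r / 2 + μ / 2`, with `μ` the largest excursion on `[t, t + δ]`. `θ`
  -- bounds both the elapsed time and the integral of the Young bound for `‖u‖`. The weight `l`
  -- makes the energy part at most `θ / 2`, and `δ` then does the same for the part `1 / (4 * l)`.
  set θ := min r 1 / (2 * N) with hθ
  have hθ0 : 0 < θ := by positivity
  have hθN : θ * N = min r 1 / 2 := by rw [hθ]; field_simp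
  set l := θ / (2 * (M + 1)) with hl
  have hl0 : 0 < l := by positivity
  have hlM : l * M ≤ θ / 2 := by
    have : l * (M + 1) = θ / 2 := by rw [hl]; field_simp
    nlinarith
  set δ := min (min θ (2 * l * θ)) (D.T - t) with hδ
  have hδ0 : 0 < δ := lt_min (lt_min hθ0 (by positivity)) (sub_pos.2 ht.2)
  have hδθ : δ ≤ θ := (min_le_left _ _).trans (min_le_left _ _)
  have hδl : δ * (1 / (4 * l)) ≤ θ / 2 := by
    have : δ ≤ 2 * l * θ := (min_le_left _ _).trans (min_le_right _ _)
    rw [mul_one_div, div_le_iff₀ (by positivity)]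
    linarith
  have hδT : t + δ ≤ D.T := by linarith [min_le_right (min θ (2 * l * θ)) (D.T - t)]
  refine ⟨δ, hδ0, hδT, fun X u hX hu s hs => ?_⟩
  have hXδ := hX.mono hδT
  obtain ⟨s₀, hs₀, hmax⟩ := isCompact_Icc.exists_isMaxOn ⟨s, hs⟩
    ((hXδ.2.1.sub continuousOn_const).norm (f := fun s => X s - x))
  refine (hmax hs).trans ?_
  set μ := ‖X s₀ - x‖ with hμ
  change μ ≤ r
  have hμ0 : 0 ≤ μ := norm_nonneg _
  have hu2 : IntegrableOn (fun s => ‖u s‖ ^ 2) (Icc t D.T) :=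
    (memLp_two_iff_integrable_sq_norm hX.1.1).1 hX.1
  have hu2' : IntervalIntegrable (fun s => ‖u s‖ ^ 2) volume t s₀ := by
    rw [intervalIntegrable_iff_integrableOn_Icc_of_le hs₀.1]
    exact hu2.mono_set (Icc_subset_Icc_right (hs₀.2.trans hδT))
  have huM : ∫ s in t..s₀, ‖u s‖ ^ 2 ≤ M := by
    refine le_trans ?_ hu
    refine intervalIntegral.integral_mono_interval le_rfl hs₀.1 (hs₀.2.trans hδT)
      (Filter.Eventually.of_forall fun s => sq_nonneg _) ?_
    rw [intervalIntegrable_iff_integrableOn_Icc_of_le ht.2.le]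
    exact hu2
  have hvel : ∀ s ∈ Icc t s₀, ‖D.velocity s (X s) (u s)‖
      ≤ (MA + LA * μ) + (MB + LB' * μ) * (l * ‖u s‖ ^ 2 + 1 / (4 * l)) := by
    intro s hs
    have hsT : s ∈ Icc 0 D.T := ⟨ht.1.trans hs.1, hs.2.trans (hs₀.2.trans hδT)⟩
    have hsμ : ‖X s - x‖ ≤ μ := hmax (⟨hs.1, hs.2.trans hs₀.2⟩ : s ∈ Icc t (t + δ))
    have hA' : ‖D.A s (X s)‖ ≤ MA + LA * μ :=
      calc ‖D.A s (X s)‖ ≤ ‖D.A s x‖ + ‖D.A s (X s) - D.A s x‖ := norm_le_norm_add_norm_sub' _ _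
        _ ≤ MA + LA * ‖X s - x‖ := add_le_add (hMA s hsT) (hlA s hsT _ _)
        _ ≤ MA + LA * μ := by gcongr
    have hB' : ‖D.B s (X s)‖ ≤ MB + LB' * μ :=
      calc ‖D.B s (X s)‖ ≤ ‖D.B s x‖ + ‖D.B s (X s) - D.B s x‖ := norm_le_norm_add_norm_sub' _ _
        _ ≤ MB + LB' * ‖X s - x‖ := add_le_add (hMB s hsT) (hlB s hsT _ _)
        _ ≤ MB + LB' * μ := by gcongr
    have hyoung : ‖u s‖ ≤ l * ‖u s‖ ^ 2 + 1 / (4 * l) := by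
      rw [← sub_nonneg]
      have : l * ‖u s‖ ^ 2 + 1 / (4 * l) - ‖u s‖ = (2 * l * ‖u s‖ - 1) ^ 2 / (4 * l) := by
        field_simp
        ring
      rw [this]
      positivity
    refine (norm_add_le _ _).trans (add_le_add hA' (((D.B s (X s)).le_opNorm _).trans ?_))
    gcongr
  have hint : μ ≤ ∫ s in t..s₀,
      ((MA + LA * μ) + (MB + LB' * μ) * (l * ‖u s‖ ^ 2 + 1 / (4 * l))) := by
    have hXs : X s₀ - x = ∫ s in t..s₀, D.velocity s (X s) (u s) := by
      rw [hXδ.2.2.2 s₀ hs₀]; abel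
    have hμe : μ = ‖∫ s in t..s₀, D.velocity s (X s) (u s)‖ := by rw [← hXs]
    refine hμe.le.trans ((intervalIntegral.norm_integral_le_integral_norm hs₀.1).trans ?_)
    refine intervalIntegral.integral_mono_on hs₀.1
      ((hXδ.mono hs₀.2).intervalIntegrable hs₀.1).norm ?_ hvel
    exact intervalIntegrable_const.add
      (((hu2'.const_mul l).add intervalIntegrable_const).const_mul _)
  rw [intervalIntegral.integral_add intervalIntegrable_const
    (((hu2'.const_mul l).add intervalIntegrable_const).const_mul _),
    intervalIntegral.integral_const_mul,
    intervalIntegral.integral_add (hu2'.const_mul l) intervalIntegrable_const,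
    intervalIntegral.integral_const_mul, intervalIntegral.integral_const,
    intervalIntegral.integral_const, smul_eq_mul, smul_eq_mul] at hint
  have hs₀δ : s₀ - t ≤ δ := by linarith [hs₀.2]
  have hη : l * (∫ s in t..s₀, ‖u s‖ ^ 2) + (s₀ - t) * (1 / (4 * l)) ≤ θ := by
    have e1 : l * (∫ s in t..s₀, ‖u s‖ ^ 2) ≤ l * M := by gcongr
    have e2 : (s₀ - t) * (1 / (4 * l)) ≤ δ * (1 / (4 * l)) := by gcongr
    linarith
  have e3 : (s₀ - t) * (MA + LA * μ) ≤ θ * (MA + LA * μ) := by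
    gcongr; linarith
  have e4 : (MB + LB' * μ) * (l * (∫ s in t..s₀, ‖u s‖ ^ 2) + (s₀ - t) * (1 / (4 * l)))
      ≤ (MB + LB' * μ) * θ := by gcongr
  have e5 : θ * (MA + MB) ≤ r / 2 := by
    have : θ * (MA + MB) ≤ θ * N := by gcongr; linarith
    linarith [min_le_left r 1]
  have e6 : θ * (LA + LB') * μ ≤ 1 / 2 * μ := by
    have : θ * (LA + LB') ≤ θ * N := by gcongr; linarith
    gcongr
    linarith [min_le_right r 1]
  nlinarith

/-- The Hamilton–Jacobi–Bellman equation. -/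
theorem minHamiltonian_eq_zero (h1 : D.H1) (h2 : D.H2) (hV : D.TwiceDifferentiable D.value) {t : ℝ}
    (ht : t ∈ Icc 0 D.T) (x : Euc n) : D.minHamiltonian t x = 0 := by
  have hcont := continuousOn_minHamiltonian h1 h2 hV
  have hcl := closure_Ico D.T_pos.ne
  refine le_antisymm ?_ (minHamiltonian_nonneg h1 h2 hV ht x)
  refine le_on_closure (s := Ico 0 D.T) (f := fun s => D.minHamiltonian s x)
    (g := fun _ => (0 : ℝ)) (fun t ht => ?_) ?_ continuousOn_const (hcl ▸ ht)
  swap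
  · rw [hcl]
    exact continuousOn_along hcont le_rfl le_rfl continuousOn_const
  by_contra! hpos
  have htI : t ∈ Icc 0 D.T := Ico_subset_Icc_self ht
  set c := D.minHamiltonian t x with hc
  obtain ⟨r, hr, hd⟩ := Metric.continuousWithinAt_iff.1 (hcont (t, x) ⟨htI, mem_univ _⟩) (c / 2)
    (by linarith)
  obtain ⟨κ, hκ, C, hcost⟩ := h2.exists_cost_lower_bound
  -- This energy bound holds for every control within `1` of optimality, so it is fixed before `δ`;
  -- the tolerance below is therefore capped at `1`.
  set M := max 0 ((D.value t x + 1 + C) / κ) with hM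
  obtain ⟨δ₀, hδ₀, hδ₀T, hnear⟩ := exists_forall_norm_sub_le h1 ht x (half_pos hr)
    (le_max_left 0 ((D.value t x + 1 + C) / κ))
  set δ := min δ₀ (r / 2) with hδ
  have hδ0 : 0 < δ := lt_min hδ₀ (half_pos hr)
  have hδδ₀ : δ ≤ δ₀ := min_le_left _ _
  have hδr : δ ≤ r / 2 := min_le_right _ _
  obtain ⟨X, u, hX, hlt⟩ := exists_cost_lt h1 htI x
    (lt_min one_pos (show 0 < δ * (c / 2) by positivity))
  have hu : ∫ s in t..D.T, ‖u s‖ ^ 2 ≤ M := by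
    refine le_max_of_le_right ?_
    rw [le_div_iff₀ hκ]
    linarith [hcost t htI x X u hX, min_le_left 1 (δ * (c / 2))]
  have hint := cost_sub_value h1 h2 hV htI hX
  have hti := intervalIntegrable_hamiltonian h2 hV ht.1 ht.2.le le_rfl hX
  have htδ : t + δ ∈ Icc t D.T := ⟨by linarith, by linarith⟩
  have hi1 : IntervalIntegrable (fun s => D.hamiltonian s (X s) (u s)) volume t (t + δ) :=
    hti.mono_set (uIcc_subset_uIcc left_mem_uIcc (by rwa [uIcc_of_le ht.2.le]))
  have hi2 : IntervalIntegrable (fun s => D.hamiltonian s (X s) (u s)) volume (t + δ) D.T :=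
    hti.mono_set (uIcc_subset_uIcc (by rwa [uIcc_of_le ht.2.le]) right_mem_uIcc)
  rw [← intervalIntegral.integral_add_adjacent_intervals hi1 hi2] at hint
  -- On `[t, t + δ]` the path stays where the minimum exceeds `c / 2`. As the rest contributes
  -- nonnegatively, the cost exceeds the value by at least `δ * (c / 2)`, against the choice of
  -- control.
  have hl : δ * (c / 2) ≤ ∫ s in t..t + δ, D.hamiltonian s (X s) (u s) := by
    have := intervalIntegral.integral_mono_on htδ.1 (intervalIntegrable_const (c := c / 2)) hi1
      fun s hs => ?_
    · rwa [intervalIntegral.integral_const, add_sub_cancel_left, smul_eq_mul] at this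
    · have hsT : s ∈ Icc 0 D.T := ⟨ht.1.trans hs.1, hs.2.trans htδ.2⟩
      have hdist : dist (s, X s) (t, x) < r := by
        rw [Prod.dist_eq]
        refine max_lt ?_ ?_
        · rw [Real.dist_eq, abs_of_nonneg (sub_nonneg.2 hs.1)]
          linarith [hs.2]
        · rw [dist_eq_norm]
          linarith [hnear X u hX hu s ⟨hs.1, by linarith [hs.2]⟩]
      have h3 := hd (x := (s, X s)) ⟨hsT, mem_univ _⟩ hdist
      rw [Real.dist_eq] at h3
      have h4 := minHamiltonian_le h2 hV hsT (X s) (u s)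
      have h5 := neg_abs_le (D.minHamiltonian s (X s) - D.minHamiltonian t x)
      simp only at h3
      linarith
  have hr' : 0 ≤ ∫ s in t + δ..D.T, D.hamiltonian s (X s) (u s) := by
    refine intervalIntegral.integral_nonneg htδ.2 fun s hs => ?_
    have hsT : s ∈ Icc 0 D.T := ⟨by linarith [hs.1, htδ.1, ht.1], hs.2⟩
    exact (minHamiltonian_nonneg h1 h2 hV hsT _).trans (minHamiltonian_le h2 hV hsT _ _)
  linarith [min_le_right 1 (δ * (c / 2))]

/-! ### Optimal controls -/

/-- Optimal controls minimize the Hamiltonian along the optimal trajectory. -/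
theorem IsOptimalPair.ae_eq_feedback (h1 : D.H1) (h2 : D.H2) (hV : D.TwiceDifferentiable D.value)
    {t : ℝ} (ht : t ∈ Icc 0 D.T) {x : Euc n} {X : ℝ → Euc n} {u : ℝ → Euc m}
    (h : D.IsOptimalPair t x X u) :
    ∀ᵐ s ∂(volume.restrict (Icc t D.T)), u s = D.feedback s (X s) := by
  have hX : D.IsPathOn t D.T x X u := h.1
  have hint := cost_sub_value h1 h2 hV ht hX
  rw [h.2, sub_self, intervalIntegral.integral_of_le ht.2, ← integral_Icc_eq_integral_Ioc] at hint
  have hham : ∀ s ∈ Icc t D.T, D.hamiltonian s (X s) (u s)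
      = 1 / 2 * inner ℝ (D.R s (X s) (u s - D.feedback s (X s))) (u s - D.feedback s (X s)) := by
    intro s hs
    have hsT : s ∈ Icc 0 D.T := ⟨ht.1.trans hs.1, hs.2⟩
    rw [hamiltonian_eq h2 hV hsT, minHamiltonian_eq_zero h1 h2 hV hsT, zero_add]
  have hnn : 0 ≤ᵐ[volume.restrict (Icc t D.T)] fun s => D.hamiltonian s (X s) (u s) := by
    filter_upwards [ae_restrict_mem measurableSet_Icc] with s hs
    simp only [hham s hs, Pi.zero_apply]
    have := inner_R_nonneg h2 ⟨ht.1.trans hs.1, hs.2⟩ (X s) (u s - D.feedback s (X s))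
    positivity
  -- A nonnegative integrand with zero integral vanishes almost everywhere; coercivity of `R` then
  -- forces the control to be the feedback.
  have hzero := (setIntegral_eq_zero_iff_of_nonneg_ae hnn
    ((integrableOn_valueDeriv hV ht.1 le_rfl hX).add
      (integrableOn_running h2 ht.1 le_rfl hX.2.1 hX.1))).1 hint
  obtain ⟨c, hc, hcoer⟩ := h2.exists_coercive
  filter_upwards [hzero, ae_restrict_mem measurableSet_Icc] with s hs0 hs
  rw [hham s hs] at hs0
  have h3 := hcoer s ⟨ht.1.trans hs.1, hs.2⟩ (X s) (u s - D.feedback s (X s))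
  simp only [Pi.zero_apply] at hs0
  have h4 : ‖u s - D.feedback s (X s)‖ ^ 2 ≤ 0 :=
    nonpos_of_mul_nonpos_right (h3.trans (by linarith)) hc
  exact sub_eq_zero.1 (norm_eq_zero.1
    (pow_eq_zero_iff two_ne_zero |>.1 (le_antisymm h4 (sq_nonneg _))))

/-! ### Second derivatives and the quasi-Riccati equation -/

variable (D) in
theorem convex_dom : Convex ℝ D.dom := (convex_Icc 0 D.T).prod convex_univ

variable (D) in
theorem nonempty_interior_dom : (interior D.dom).Nonempty := by
  rw [dom, interior_prod_eq, interior_Icc, interior_univ]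
  exact ⟨(D.T / 2, 0), ⟨by linarith [D.T_pos], by linarith [D.T_pos]⟩, mem_univ _⟩

theorem differentiableAt_slice {F : Type*} [NormedAddCommGroup F] [NormedSpace ℝ F]
    {f : ℝ → Euc n → F} (hf : ContDiffOn ℝ 2 (fun p : ℝ × Euc n => f p.1 p.2) D.dom) {t : ℝ}
    (ht : t ∈ Icc 0 D.T) (x : Euc n) : DifferentiableAt ℝ (f t) x :=
  (hasFDerivAt_slice ht (x := x)
    (hf.differentiableOn two_ne_zero (t, x) ⟨ht, mem_univ _⟩).hasFDerivWithinAt).differentiableAt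

theorem hasDerivWithinAt_slice {F : Type*} [NormedAddCommGroup F] [NormedSpace ℝ F]
    {f : ℝ × Euc n → F} {t : ℝ} {x : Euc n} {f' : ℝ × Euc n →L[ℝ] F}
    (hf : HasFDerivWithinAt f f' D.dom (t, x)) :
    HasDerivWithinAt (fun s => f (s, x)) (f' (1, 0)) (Icc 0 D.T) t :=
  hf.comp_hasDerivWithinAt (f := fun s => (s, x)) t
    ((hasDerivWithinAt_id t _).prodMk (hasDerivWithinAt_const t _ x))
    fun _ hs => ⟨hs, mem_univ _⟩

theorem TwiceDifferentiable.hasFDerivWithinAt_valueDeriv (hV : D.TwiceDifferentiable D.value)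
    {p : ℝ × Euc n} (hp : p ∈ D.dom) :
    HasFDerivWithinAt D.valueDeriv (fderivWithin ℝ D.valueDeriv D.dom p) D.dom p :=
  (hV.2 p hp).hasFDerivWithinAt

/-- Symmetry holds up to the boundary times, without continuity of the second derivative, because
the domain is convex with nonempty interior. -/
theorem TwiceDifferentiable.second_derivative_symm (hV : D.TwiceDifferentiable D.value)
    {p : ℝ × Euc n} (hp : p ∈ D.dom) (v w : ℝ × Euc n) :
    fderivWithin ℝ D.valueDeriv D.dom p v w = fderivWithin ℝ D.valueDeriv D.dom p w v :=
  D.convex_dom.second_derivative_within_at_symmetric D.nonempty_interior_dom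
    (fun _ hq => (hV.hasFDerivWithinAt (interior_subset hq)).hasFDerivAt
      (mem_interior_iff_mem_nhds.1 hq)) hp
    ((hV.hasFDerivWithinAt_valueDeriv hp).mono interior_subset) v w

variable (D) in
/-- The derivative of the gradient in space of the value function. -/
def gradientDeriv (p : ℝ × Euc n) : ℝ × Euc n →L[ℝ] Euc n :=
  (InnerProductSpace.toDual ℝ (Euc n)).symm.toContinuousLinearEquiv.toContinuousLinearMap ∘L
    (ContinuousLinearMap.compL ℝ (Euc n) (ℝ × Euc n) ℝ).flip
      (ContinuousLinearMap.inr ℝ ℝ (Euc n)) ∘L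
    fderivWithin ℝ D.valueDeriv D.dom p

theorem inner_gradientDeriv (p v : ℝ × Euc n) (y : Euc n) :
    inner ℝ (D.gradientDeriv p v) y = fderivWithin ℝ D.valueDeriv D.dom p v (0, y) := by
  change inner ℝ ((InnerProductSpace.toDual ℝ (Euc n)).symm
    (fderivWithin ℝ D.valueDeriv D.dom p v ∘L ContinuousLinearMap.inr ℝ ℝ (Euc n))) y = _
  rw [InnerProductSpace.toDual_symm_apply]
  rfl

/-- The gradient is a fixed linear image of `valueDeriv`: restriction to space directions followed
by the Riesz isomorphism. -/
theorem TwiceDifferentiable.hasFDerivWithinAt_gradient (hV : D.TwiceDifferentiable D.value)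
    {p : ℝ × Euc n} (hp : p ∈ D.dom) :
    HasFDerivWithinAt (fun p : ℝ × Euc n => gradient (D.value p.1) p.2) (D.gradientDeriv p)
      D.dom p := by
  have h := (((InnerProductSpace.toDual ℝ (Euc n)).symm.toContinuousLinearEquiv.toContinuousLinearMap
    ∘L (ContinuousLinearMap.compL ℝ (Euc n) (ℝ × Euc n) ℝ).flip
      (ContinuousLinearMap.inr ℝ ℝ (Euc n))).hasFDerivAt).comp_hasFDerivWithinAt p
        (hV.hasFDerivWithinAt_valueDeriv hp)
  exact h.congr (fun q hq => hV.gradient_eq hq.1 q.2) (hV.gradient_eq hp.1 p.2)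

theorem inner_inverse_R_comm (h2 : D.H2) {t : ℝ} (ht : t ∈ Icc 0 D.T) (x : Euc n) (u v : Euc m) :
    inner ℝ u ((D.R t x).inverse v) = inner ℝ ((D.R t x).inverse u) v := by
  have h := h2.isInvertible ht x
  conv_lhs => rw [← h.apply_inverse u, h2.inner_R_comm ht, h.apply_inverse]

/-- The quasi-Riccati equation, the space derivative of the Hamilton–Jacobi–Bellman equation. -/
theorem quasiRiccati (h1 : D.H1) (h2 : D.H2) (h3 : D.H3)
    {B₀ : ℝ → (Euc m →L[ℝ] Euc n)} {R₀ : ℝ → (Euc m →L[ℝ] Euc m)}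
    (hB : ∀ t ∈ Icc 0 D.T, ∀ x : Euc n, D.B t x = B₀ t)
    (hR : ∀ t ∈ Icc 0 D.T, ∀ x : Euc n, D.R t x = R₀ t)
    (hV : D.TwiceDifferentiable D.value) {t : ℝ} (ht : t ∈ Icc 0 D.T) (x : Euc n) :
    D.gradientDeriv (t, x) (1, 0) + D.gradientDeriv (t, x) (0, D.A t x)
      + ContinuousLinearMap.adjoint (fderiv ℝ (D.A t) x) (gradient (D.value t) x)
      + gradient (D.Q t) x
      - (D.gradientDeriv (t, x) (0, B₀ t ((R₀ t).inverse (D.switching t x)))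
        + ContinuousLinearMap.adjoint (fderiv ℝ (D.S t) x)
            ((R₀ t).inverse (D.switching t x))) = 0 := by
  have hp : (t, x) ∈ D.dom := ⟨ht, mem_univ _⟩
  have hA := (differentiableAt_slice h3.1 ht x).hasFDerivAt
  have hQ := (differentiableAt_slice h3.2.2.1 ht x).hasFDerivAt
  have hS := (differentiableAt_slice h3.2.2.2.1 ht x).hasFDerivAt
  have hVd := hasFDerivAt_slice ht (hV.hasFDerivWithinAt_valueDeriv hp)
  have hP := hasFDerivAt_slice ht (hV.hasFDerivWithinAt_gradient hp)
  have hq : HasFDerivAt (fun y => D.switching t y)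
      (ContinuousLinearMap.adjoint (B₀ t) ∘L
        (D.gradientDeriv (t, x) ∘L ContinuousLinearMap.inr ℝ ℝ (Euc n)) + fderiv ℝ (D.S t) x) x := by
    have := ((ContinuousLinearMap.adjoint (B₀ t)).hasFDerivAt.comp x hP).add hS
    refine this.congr_of_eventuallyEq (Filter.Eventually.of_forall fun y => ?_)
    simp [switching, hB t ht]
  have hA1 : HasFDerivAt (fun y => ((1 : ℝ), D.A t y))
      (ContinuousLinearMap.inr ℝ ℝ (Euc n) ∘L fderiv ℝ (D.A t) x) x :=
    (hasFDerivAt_prodMk_right (1 : ℝ) (D.A t x)).comp x hA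
  -- Since `B₀` and `R₀` do not depend on the state, the quadratic term is differentiated only
  -- through `A`-free factors: the gradient of `V` and `S` in `switching`.
  have hH := ((hVd.clm_apply hA1).add hQ).sub
    ((hq.inner ℝ (((R₀ t).inverse).hasFDerivAt.comp x hq)).const_mul (1 / 2))
  have hzero : HasFDerivAt (fun y => D.minHamiltonian t y) (0 : Euc n →L[ℝ] ℝ) x := by
    simp only [minHamiltonian_eq_zero h1 h2 hV ht]
    exact hasFDerivAt_const _ _
  have huniq := HasFDerivAt.unique hzero (hH.congr_of_eventuallyEq
    (Filter.Eventually.of_forall fun y => by simp [minHamiltonian, hR t ht]))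
  refine ext_inner_right ℝ fun y => ?_
  have hy := congrArg (fun L : Euc n →L[ℝ] ℝ => L y) huniq
  set w := (R₀ t).inverse (D.switching t x) with hw
  set z := ContinuousLinearMap.adjoint (B₀ t) (D.gradientDeriv (t, x) (0, y))
    + fderiv ℝ (D.S t) x y with hz
  -- Symmetry of the inverse of `R` makes the two product-rule terms equal, which cancels the factor
  -- `1 / 2`.
  have hRz : inner ℝ (D.switching t x) ((R₀ t).inverse z) = inner ℝ w z := by
    rw [hw, ← hR t ht x, inner_inverse_R_comm h2 ht]
  have hzw : inner ℝ w z = inner ℝ (D.gradientDeriv (t, x) (0, B₀ t w)) y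
      + inner ℝ (ContinuousLinearMap.adjoint (fderiv ℝ (D.S t) x) w) y := by
    rw [hz, inner_add_right, ContinuousLinearMap.adjoint_inner_right,
      ContinuousLinearMap.adjoint_inner_left, real_inner_comm, inner_gradientDeriv,
      inner_gradientDeriv, hV.second_derivative_symm hp]
  -- Symmetry of the second derivative turns the derivative of `V_t + V_x A`, with `A` frozen, into
  -- `P_t + P_x A`.
  have h1A : fderivWithin ℝ D.valueDeriv D.dom (t, x) (0, y) (1, D.A t x)
      = inner ℝ (D.gradientDeriv (t, x) (1, 0)) y
        + inner ℝ (D.gradientDeriv (t, x) (0, D.A t x)) y := by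
    rw [hV.second_derivative_symm hp, ← inner_gradientDeriv, ← inner_add_left, ← map_add]
    simp
  have hAx : D.valueDeriv (t, x) (0, fderiv ℝ (D.A t) x y)
      = inner ℝ (ContinuousLinearMap.adjoint (fderiv ℝ (D.A t) x) (gradient (D.value t) x)) y := by
    rw [ContinuousLinearMap.adjoint_inner_left, hV.inner_gradient ht]
  have hQx : fderiv ℝ (D.Q t) x y = inner ℝ (gradient (D.Q t) x) y := by
    rw [gradient, InnerProductSpace.toDual_symm_apply]
  have hy' : 0 = fderivWithin ℝ D.valueDeriv D.dom (t, x) (0, y) (1, D.A t x)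
      + D.valueDeriv (t, x) (0, fderiv ℝ (D.A t) x y) + fderiv ℝ (D.Q t) x y
      - 1 / 2 * (inner ℝ (D.switching t x) ((R₀ t).inverse z) + inner ℝ z w) := by
    refine hy.trans ?_
    simp [hz, hw, fderivInnerCLM_apply]
    ring
  rw [real_inner_comm w z, hRz, hzw, h1A, hAx, hQx] at hy'
  simp only [inner_add_left, inner_sub_left, inner_zero_left]
  linarith

end AQProblem

end

/-! ### Conclusion -/

theorem proposition6p1 {n m : ℕ} (D : AQProblem n m)
    (h1 : D.H1) (h2 : D.H2) (h3 : D.H3)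
    (B₀ : ℝ → (Euc m →L[ℝ] Euc n)) (R₀ : ℝ → (Euc m →L[ℝ] Euc m))
    (hB : ∀ t ∈ Set.Icc 0 D.T, ∀ x : Euc n, D.B t x = B₀ t)
    (hR : ∀ t ∈ Set.Icc 0 D.T, ∀ x : Euc n, D.R t x = R₀ t)
    (hV : D.TwiceDifferentiable D.value)
    (P : ℝ → Euc n → Euc n) (hP : ∀ t x, P t x = gradient (D.value t) x) :
    D.SolvesQuasiRiccati B₀ R₀ P ∧
    ∀ t ∈ Set.Icc 0 D.T, ∀ (x : Euc n) (X : ℝ → Euc n) (u : ℝ → Euc m),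
      D.IsOptimalPair t x X u →
      ∀ᵐ s ∂(MeasureTheory.volume.restrict (Set.Icc t D.T)),
        u s = -(R₀ s).inverse
          (ContinuousLinearMap.adjoint (B₀ s) (P s (X s)) + D.S s (X s)) := by
  obtain rfl : P = fun t x => gradient (D.value t) x := funext₂ hP
  refine ⟨⟨fun p hp => (hV.hasFDerivWithinAt_gradient hp).differentiableWithinAt,
    fun t ht x => ?_, fun x => ?_⟩, fun t ht x X u hXu => ?_⟩
  · have hp : (t, x) ∈ D.dom := ⟨ht, Set.mem_univ _⟩
    have hPd := hV.hasFDerivWithinAt_gradient hp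
    rw [(AQProblem.hasDerivWithinAt_slice hPd).derivWithin
      (uniqueDiffOn_Icc D.T_pos t ht), (AQProblem.hasFDerivAt_slice ht hPd).fderiv]
    simpa [AQProblem.switching, hB t ht] using AQProblem.quasiRiccati h1 h2 h3 hB hR hV ht x
  · change gradient (D.value D.T) x = gradient D.G x
    rw [funext (AQProblem.value_terminal h1)]
  · filter_upwards [hXu.ae_eq_feedback h1 h2 hV ht,
      MeasureTheory.ae_restrict_mem measurableSet_Icc] with s hs hsI
    have hsT : s ∈ Set.Icc 0 D.T := ⟨ht.1.trans hsI.1, hsI.2⟩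
    simp only [hs, AQProblem.feedback, AQProblem.switching, hB s hsT, hR s hsT]
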